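/- Let $G=(V,m,E,a)$ be a finite weighted directed graph: $V$ is a finite set, $m:V\to(0,\infty)$, $a:V\times V\to[0,\infty)$, and $E=\{(i,j):a(i,j)>0\}$; the edge $(i,j)$ originates at $j$ and terminates at $i$. Let $\ell^2(G)$ be the space of functions $f:V\to\mathbb C$ with inner product $\langle f,g\rangle=\sum_{x}\overline{f(x)}g(x)m(x)$. For weights $w:V\times V\to[0,\infty)$ the out-degree Laplacian is $$[L^+_w f](x)=\frac1{m(x)}\Big(\sum_{j}w(j,x)\,f(x)-\sum_{y}w(x,y)f(y)\Big).$$ Fix $\tilde E\subseteq E$, let $L^+_{\tilde E}$ and $L^+_{E\setminus\tilde E}$ be the out-degree Laplacians for the restrictions of $a$ to $\tilde E$ and to $E\setminus\tilde E$, and put $L^+_\beta=L^+_{E\setminus\tilde E}+\beta L^+_{\tilde E}$ for $\beta\in\mathbb R$. Let $\tilde E^{\intercal}=\{(i,j):(j,i)\in\tilde E\}$. A reach of $(V,\tilde E^\intercal)$ is a maximal set among the sets $\{v: v \text{ can be reached from } u \text{ by a (possibly empty) directed path in } \tilde E^\intercal\}$, $u\in V$; $\mathfrak R^\intercal$ is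 the set of these reaches. The exclusive part $H(R)$ of a reach $R$ consists of its nodes lying in no other reach, and $C(R)=R\setminus H(R)$ is its common part. For $R\in\mathfrak R^\intercal$ set: * $\omega_R(i)=\sum_T\prod_{(x,y)\in T}a(y,x)$, summed over all directed spanning trees $T\subseteq\tilde E^\intercal$ of $R$ rooted at $i$ (with $\omega_R(i)=0$ if $i\notin R$), and $\vec\gamma_R=\omega_R/\sum_k m(k)\omega_R(k)$; * $\overleftarrow{\gamma}_R:V\to\mathbb R$ is equal to $1$ on $H(R)$, equal to $0$ outside $R$, and on $C(R)$ is determined by $[(L^+_{\tilde E})^*\overleftarrow{\gamma}_R](x)=0$ for $x\in C(R)$, i.e. $\overleftarrow{\gamma}_R|_{C(R)}=-(M_{C(R)C(R)})^{-1}(M\chi_{H(R)})|_{C(R)}$ with $M$ the matrix of the adjoint $(L^+_{\tilde E})^*$ on $\ell^2(G)$; * $\underline m^+(R)=\langle\chi_R,P^+\chi_R\rangle$, where $P^+=\frac1{2\pi i}\oint_{|z|=\varepsilon}(z-L^+_{\tilde E})^{-1}dz$ is the Riesz projection onto the point $0$ of the spectrum of $L^+_{\tilde E}$ ($\varepsilon>0$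 small enough that the closed disc of radius $\varepsilon$ contains no non-zero eigenvalue); * $\underline a^+(R,S)=\Big(\sum_{r\in R,\,s\in S}\overleftarrow{\gamma}_R(r)\,a(r,s)\,\vec\gamma_S(s)\Big)\underline m^+(S)$ for $S\in\mathfrak R^\intercal$. Then $\underline m^+(R)>0$ and $\underline a^+(R,S)\ge0$ for all $R,S$, so that these data define a weighted directed graph $\underline G^+$ with node set $\mathfrak R^\intercal$; let $\underline L^+$ be its out-degree Laplacian on $\ell^2(\underline G^+)$. Define $J^+_\downarrow:\ell^2(G)\to\ell^2(\underline G^+)$ and $J^+_\uparrow:\ell^2(\underline G^+)\to\ell^2(G)$ by $$[J^+_\downarrow f](R)=\frac{\langle\overleftarrow{\gamma}_R,f\rangle_{\ell^2(G)}}{\underline m^+(R)},\qquad J^+_\uparrow\underline f=\sum_{R\in\mathfrak R^\intercal}\underline m^+(R)\,\underline f(R)\,\vec\gamma_R .$$ For every $t>0$, in the operator norm of $\ell^2(G)$, $$\big\|e^{-tL^+_\beta}-J^+_\uparrow e^{-t\underline L^+}J^+_\downarrow\big\|\longrightarrow0\qquad\text{as }\beta\to\infty .$$ -/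

import Mathlib

open Filter Topology

/-- A finite weighted directed graph: positive node masses `m` and nonnegative edge weights `a`.
The pair `(i, j)` is an edge iff `0 < a i j`; it originates at `j` and terminates at `i`. -/
structure WeightedDigraph (V : Type*) where
  m : V → ℝ
  m_pos : ∀ v, 0 < m v
  a : V → V → ℝ
  a_nonneg : ∀ v w, 0 ≤ a v w

/-! ### Reachability and reaches of `(V, F)` -/

section Reaches

variable {V : Type*}

/-- The edge set of the transposed graph. -/
def transposeEdges (F : Set (V × V)) : Set (V × V) := {e | (e.2, e.1) ∈ F}

/-- There is an edge of `F` originating at `u` and terminating at `v`. -/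
def EdgeFromTo (F : Set (V × V)) (u v : V) : Prop := (v, u) ∈ F

/-- All nodes that can be reached from `u` along a (possibly empty) directed path in `F`. -/
def reachableFrom (F : Set (V × V)) (u : V) : Set V :=
  {v | Relation.ReflTransGen (EdgeFromTo F) u v}

/-- A reach of `(V, F)`: a maximal reachable set. -/
def IsReach (F : Set (V × V)) (R : Set V) : Prop :=
  Maximal (fun S : Set V => ∃ u, S = reachableFrom F u) R

/-- The set of reaches of `(V, F)`. -/
def Reach (F : Set (V × V)) : Type _ := {R : Set V // IsReach F R}

noncomputable instance [Fintype V] (F : Set (V × V)) : Fintype (Reach F) :=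
  @Fintype.ofFinite _ (inferInstanceAs (Finite {R : Set V // IsReach F R}))

/-- The exclusive part of a reach: its nodes that lie in no other reach. -/
def exclusivePart (F : Set (V × V)) (R : Reach F) : Set V :=
  {v | v ∈ R.1 ∧ ∀ S : Reach F, S ≠ R → v ∉ S.1}

/-- The common part of a reach: its nodes that also lie in some other reach. -/
def commonPart (F : Set (V × V)) (R : Reach F) : Set V :=
  {v | v ∈ R.1 ∧ ∃ S : Reach F, S ≠ R ∧ v ∈ S.1}

/-- `T` is (the edge set of) a directed spanning tree, rooted at `i`, of the subgraph of `(V, F)`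
induced on `R`: no edge enters the root, exactly one edge enters every other node of `R`, and
every node of `R` is reached from the root along `T`. -/
def IsSpanningTree (F : Set (V × V)) (R : Set V) (i : V) (T : Finset (V × V)) : Prop :=
  i ∈ R ∧ (∀ e ∈ T, e ∈ F ∧ e.1 ∈ R ∧ e.2 ∈ R) ∧ (∀ e ∈ T, e.1 ≠ i) ∧
    (∀ v ∈ R, v ≠ i → ∃! u, (v, u) ∈ T) ∧
    ∀ v ∈ R, Relation.ReflTransGen (EdgeFromTo (T : Set (V × V))) i v

open Classical in
/-- The weight vector of a reach, `ω_R(i) = ∑_T ∏_{(x,y) ∈ T} w(x,y)`, the sum running over all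
spanning trees `T` of `R` rooted at `i`. -/
noncomputable def weightVector [Fintype V] (w : V → V → ℝ) (F : Set (V × V)) (R : Reach F)
    (i : V) : ℝ :=
  ∑ T : Finset (V × V) with IsSpanningTree F R.1 i T, ∏ e ∈ T, w e.1 e.2

end Reaches

/-! ### The Riesz projection onto the point `0` of the spectrum -/

section Riesz

variable {E : Type*} [NormedAddCommGroup E] [NormedSpace ℂ E] [FiniteDimensional ℂ E]

theorem exists_isolating_radius (B : E →L[ℂ] E) :
    ∃ ε : ℝ, 0 < ε ∧ Metric.closedBall (0 : ℂ) ε ∩ spectrum ℂ B ⊆ {0} := by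
  have h1 : (spectrum ℂ B).Finite := by
    refine (Module.End.finite_spectrum (B : E →ₗ[ℂ] E)).subset fun z hz h => hz ?_
    rw [spectrum.mem_resolventSet_iff] at h ⊢
    obtain ⟨u, hu⟩ := h
    refine ⟨⟨algebraMap ℂ _ z - B, LinearMap.toContinuousLinearMap (u⁻¹ : (E →ₗ[ℂ] E)ˣ).1,
      ?_, ?_⟩, rfl⟩
    · ext x
      have := LinearMap.congr_fun u.mul_inv x
      rw [hu] at this
      exact this
    · ext x
      have := LinearMap.congr_fun u.inv_mul x
      rw [hu] at this
      exact this
  have h2 : (spectrum ℂ B \ {0})ᶜ ∈ 𝓝 (0 : ℂ) :=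
    (h1.subset Set.sdiff_subset).isClosed.isOpen_compl.mem_nhds (by simp)
  obtain ⟨ε, hε, h⟩ := Metric.nhds_basis_closedBall.mem_iff.1 h2
  refine ⟨ε, hε, fun z hz => ?_⟩
  by_contra h0
  exact h hz.1 ⟨hz.2, h0⟩

/-- The Riesz projection `(2πi)⁻¹ ∮_{|z| = ε} (z - B)⁻¹ dz` onto `0`, where the closed disc of
radius `ε` contains no point of the spectrum of `B` other than (possibly) `0`. -/
noncomputable def rieszProjection (B : E →L[ℂ] E) : E →L[ℂ] E :=
  (2 * Real.pi * Complex.I : ℂ)⁻¹ •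
    ∮ z in C(0, (exists_isolating_radius B).choose), resolvent B z

end Riesz

namespace WeightedDigraph

variable {V : Type*}

/-- The edge set `E`, i.e. the support of the weight function. -/
def edges (G : WeightedDigraph V) : Set (V × V) := {e | 0 < G.a e.1 e.2}

/-! ### The Hilbert space `ℓ²(G)` -/

/-- `ℓ²(G)`: complex functions on the nodes, with inner product
`⟨f, g⟩ = ∑ x, conj (f x) * g x * m x`. -/
def Ell2 (_G : WeightedDigraph V) : Type _ := V → ℂ

instance (G : WeightedDigraph V) : AddCommGroup G.Ell2 := inferInstanceAs (AddCommGroup (V → ℂ))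

instance (G : WeightedDigraph V) : Module ℂ G.Ell2 := inferInstanceAs (Module ℂ (V → ℂ))

instance [Fintype V] (G : WeightedDigraph V) : FiniteDimensional ℂ G.Ell2 :=
  inferInstanceAs (FiniteDimensional ℂ (V → ℂ))

/-- The positive definite Hermitian form of `ℓ²(G)`. -/
@[reducible]
noncomputable def ell2Core [Fintype V] (G : WeightedDigraph V) :
    InnerProductSpace.Core ℂ G.Ell2 where
  inner f g := ∑ x, (starRingEnd ℂ) (f x) * g x * (G.m x : ℂ)
  conj_inner_symm f g := by
    simp only [map_sum, map_mul, Complex.conj_conj, Complex.conj_ofReal]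
    exact Finset.sum_congr rfl fun x _ => by ring
  re_inner_nonneg f := by
    simp only [map_sum]
    refine Finset.sum_nonneg fun x _ => ?_
    rw [← Complex.normSq_eq_conj_mul_self, ← Complex.ofReal_mul]
    exact mul_nonneg (Complex.normSq_nonneg _) (G.m_pos x).le
  add_left f g h := by
    rw [← Finset.sum_add_distrib]
    refine Finset.sum_congr rfl fun x _ => ?_
    rw [show (f + g) x = f x + g x from rfl, map_add]
    ring
  smul_left f g c := by
    rw [Finset.mul_sum]
    refine Finset.sum_congr rfl fun x _ => ?_
    rw [show (c • f) x = c * f x from rfl, map_mul]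
    ring
  definite f hf := by
    have h1 : ∑ x, Complex.normSq (f x) * G.m x = 0 := by
      have : ((∑ x, Complex.normSq (f x) * G.m x : ℝ) : ℂ) = 0 := by
        rw [← hf]
        push_cast
        exact Finset.sum_congr rfl fun x _ => by rw [Complex.normSq_eq_conj_mul_self]
      exact_mod_cast this
    have h2 := (Finset.sum_eq_zero_iff_of_nonneg fun x _ =>
      mul_nonneg (Complex.normSq_nonneg (f x)) (G.m_pos x).le).1 h1
    funext x
    have h3 := h2 x (Finset.mem_univ x)
    exact Complex.normSq_eq_zero.1 ((mul_eq_zero.1 h3).resolve_right (G.m_pos x).ne')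

noncomputable instance [Fintype V] (G : WeightedDigraph V) : NormedAddCommGroup G.Ell2 :=
  @InnerProductSpace.Core.toNormedAddCommGroup ℂ G.Ell2 _ _ _ G.ell2Core

noncomputable instance [Fintype V] (G : WeightedDigraph V) : InnerProductSpace ℂ G.Ell2 :=
  InnerProductSpace.ofCore G.ell2Core.toCore

/-- The characteristic function of a set of nodes, as an element of `ℓ²(G)`. -/
noncomputable def chi (G : WeightedDigraph V) (S : Set V) : G.Ell2 :=
  Set.indicator S (fun _ => (1 : ℂ))

/-! ### Out-degree Laplacians -/

section Laplacian

variable [Fintype V]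

/-- The out-degree Laplacian for the node masses of `G` and edge weights `w`:
`f ↦ (1 / m x) * ((∑ j, w j x) * f x - ∑ y, w x y * f y)`. -/
noncomputable def outLaplacianWith (G : WeightedDigraph V) (w : V → V → ℝ) :
    G.Ell2 →L[ℂ] G.Ell2 :=
  LinearMap.toContinuousLinearMap
    { toFun := fun f x =>
        (1 / (G.m x : ℂ)) * ((∑ j, (w j x : ℂ)) * f x - ∑ y, (w x y : ℂ) * f y)
      map_add' := fun f g => by
        funext x
        change _ * (_ * (f x + g x) - ∑ y, (w x y : ℂ) * (f y + g y)) = _ + _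
        simp only [mul_add, Finset.sum_add_distrib]
        ring
      map_smul' := fun c f => by
        funext x
        change _ * (_ * (c * f x) - ∑ y, (w x y : ℂ) * (c * f y)) = c * _
        simp only [mul_left_comm _ c, ← Finset.mul_sum]
        ring }

/-- The out-degree Laplacian `L⁺` of `G`. -/
noncomputable def outLaplacian (G : WeightedDigraph V) : G.Ell2 →L[ℂ] G.Ell2 :=
  G.outLaplacianWith G.a

open Classical in
/-- The weight function of `G` restricted to the edges in `F`. -/
noncomputable def restrictWeight (G : WeightedDigraph V) (F : Set (V × V)) (x y : V) : ℝ :=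
  if (x, y) ∈ F then G.a x y else 0

/-- The out-degree Laplacian `L⁺_F` of the subgraph with edge set `F`. -/
noncomputable def outLaplacianOn (G : WeightedDigraph V) (F : Set (V × V)) :
    G.Ell2 →L[ℂ] G.Ell2 :=
  G.outLaplacianWith (G.restrictWeight F)

/-- `L⁺_β = L⁺_{E \ F} + β L⁺_F`. -/
noncomputable def outLaplacianCoupled (G : WeightedDigraph V) (F : Set (V × V)) (β : ℝ) :
    G.Ell2 →L[ℂ] G.Ell2 :=
  G.outLaplacianOn (G.edges \ F) + (β : ℂ) • G.outLaplacianOn F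

end Laplacian

/-! ### Kernel vectors of `L⁺_F`, indexed by the reaches of the transposed graph -/

section Kernels

variable [Fintype V] (G : WeightedDigraph V) (F : Set (V × V))

/-- The right kernel vector of `L⁺_F` attached to a reach `R` of the transpose of `(V, F)`: the
multiple of the weight vector of `R` that satisfies `∑ j, ⟨e_j, γ⟩ = ∑ j, m j * γ j = 1`. -/
noncomputable def gammaRight (R : Reach (transposeEdges F)) (j : V) : ℝ :=
  weightVector (fun x y => G.a y x) (transposeEdges F) R j /
    ∑ k, G.m k * weightVector (fun x y => G.a y x) (transposeEdges F) R k

open Classical in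
/-- The matrix of the in-degree Laplacian of the transpose of `(V, F)`, which is the adjoint of
`L⁺_F` in `ℓ²(G)`. -/
noncomputable def inLaplacianTranspose : Matrix V V ℝ :=
  Matrix.of fun x y =>
    (1 / G.m x) * ((if x = y then ∑ i, G.restrictWeight F i x else 0) - G.restrictWeight F y x)

/-- The block of the matrix `inLaplacianTranspose` on the common part of a reach. -/
noncomputable def commonBlock (R : Reach (transposeEdges F)) :
    Matrix (commonPart (transposeEdges F) R) (commonPart (transposeEdges F) R) ℝ :=
  (G.inLaplacianTranspose F).submatrix Subtype.val Subtype.val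

open Classical in
/-- The left kernel vector of `L⁺_F` attached to a reach `R` of the transpose of `(V, F)`: it is
`1` on the exclusive part `H` of `R`, it vanishes outside `R`, and on the common part `C` it is
`-(M_{CC})⁻¹ (M χ_H)_C`, where `M` is the matrix of the adjoint of `L⁺_F`; that is, on `C` it
solves `M γ = 0`. -/
noncomputable def gammaLeft (R : Reach (transposeEdges F)) (j : V) : ℝ :=
  if j ∈ exclusivePart (transposeEdges F) R then 1
  else if hj : j ∈ commonPart (transposeEdges F) R then
    -((G.commonBlock F R)⁻¹.mulVec
        (fun x => ∑ y with y ∈ exclusivePart (transposeEdges F) R,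
          G.inLaplacianTranspose F x.1 y) ⟨j, hj⟩)
  else 0

end Kernels

/-! ### The reduced graph and the operators `J⁺↓`, `J⁺↑` -/

section Reduced

variable [Fintype V] (G : WeightedDigraph V) (F : Set (V × V))

/-- The mass `⟨χ_R, P⁺ χ_R⟩` of a reach, with `P⁺` the Riesz projection onto the point `0` of the
spectrum of `L⁺_F` (this number is real). -/
noncomputable def reducedMass (R : Reach (transposeEdges F)) : ℝ :=
  (inner ℂ (G.chi R.1) (rieszProjection (G.outLaplacianOn F) (G.chi R.1))).re

open Classical in
/-- The reduced edge weights
`(∑_{r ∈ R, s ∈ S} γLeft_R r * a r s * γRight_S s) * reducedMass S`. -/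
noncomputable def reducedWeight (R S : Reach (transposeEdges F)) : ℝ :=
  (∑ r with r ∈ R.1, ∑ s with s ∈ S.1, G.gammaLeft F R r * G.a r s * G.gammaRight F S s) *
    G.reducedMass F S

variable (hm : ∀ R, 0 < G.reducedMass F R) (ha : ∀ R S, 0 ≤ G.reducedWeight F R S)

/-- The reduced graph: its nodes are the reaches of the transpose of `(V, F)`. -/
noncomputable def reducedGraph : WeightedDigraph (Reach (transposeEdges F)) where
  m := G.reducedMass F
  m_pos := hm
  a := G.reducedWeight F
  a_nonneg := ha

/-- `J⁺↓ : f ↦ (R ↦ ⟨γLeft_R, f⟩ / reducedMass R)`. -/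
noncomputable def projectDown : G.Ell2 →L[ℂ] (G.reducedGraph F hm ha).Ell2 :=
  LinearMap.toContinuousLinearMap
    { toFun := fun f R =>
        inner ℂ (show G.Ell2 from fun v => (G.gammaLeft F R v : ℂ)) f / (G.reducedMass F R : ℂ)
      map_add' := fun f g => by
        funext R
        change inner ℂ _ (f + g) / _ = inner ℂ _ f / _ + inner ℂ _ g / _
        rw [inner_add_right, add_div]
      map_smul' := fun c f => by
        funext R
        change inner ℂ _ (c • f) / _ = c * (inner ℂ _ f / _)
        rw [inner_smul_right, mul_div_assoc] }

/-- `J⁺↑ : f ↦ ∑ R, reducedMass R * f R * γRight_R`. -/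
noncomputable def interpolateUp : (G.reducedGraph F hm ha).Ell2 →L[ℂ] G.Ell2 :=
  LinearMap.toContinuousLinearMap
    { toFun := fun f v => ∑ R, (G.reducedMass F R : ℂ) * f R * (G.gammaRight F R v : ℂ)
      map_add' := fun f g => by
        funext v
        change ∑ R, _ * (f R + g R) * _ = ∑ R, _ + ∑ R, _
        rw [← Finset.sum_add_distrib]
        exact Finset.sum_congr rfl fun R _ => by ring
      map_smul' := fun c f => by
        funext v
        change ∑ R, _ * (c * f R) * _ = c * ∑ R, _
        rw [Finset.mul_sum]
        exact Finset.sum_congr rfl fun R _ => by ring }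

end Reduced

end WeightedDigraph

/-!
Write `L₀ = L⁺_{E \ F}` and `L₁ = L⁺_F`. In the mass-weighted `ℓ¹` norm, `L₀ + β L₁` is a multiple
`κ (1 - K)` of `1 - K` with `K` a contraction, so its semigroup is an average of the powers of `K`
with Poisson weights. Hence the semigroup is bounded uniformly in `β ≥ 0`, and
`(L₀ + β L₁) exp (-t (L₀ + β L₁)) = O(√(κ / t))` with `κ` proportional to `1 + β`.

Let `P` be the projection onto the kernel of `L₁` along its range, so that `1 - P = L₁ Z` for some
`Z`. On the range of `1 - P` the semigroup tends to `0`, because up to bounded terms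
`exp (-t (L₀ + β L₁)) (1 - P)` is `β⁻¹` times the decaying quantity above. On the range of `P`,
Duhamel's formula compares it with `W = exp (-t P L₀) P`, once `W` is corrected by `-β⁻¹ Z L₀ W` to
cancel the term of order `1` in the equation.

The reaches of the transpose of `(V, F)` index biorthogonal bases of the left and the right kernel
of `L₁`: `gammaRight` lies in the kernel by the Markov chain tree theorem, and the `gammaLeft` span
the kernel of the adjoint by the maximum principle. These bases give `P`, and Cauchy's formula
identifies it with the Riesz projection. In them `P L₀ P` is the Laplacian of the reduced graph.
-/

section PoissonWeight

/-- The probability of `n` under the Poisson law of parameter `s`. -/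
noncomputable def poissonWeight (s : ℝ) (n : ℕ) : ℝ :=
  Real.exp (-s) * (s ^ n / n.factorial)

theorem poissonWeight_nonneg {s : ℝ} (hs : 0 ≤ s) (n : ℕ) : 0 ≤ poissonWeight s n := by
  unfold poissonWeight
  positivity

theorem hasSum_poissonWeight (s : ℝ) : HasSum (poissonWeight s) 1 := by
  have h := (NormedSpace.expSeries_div_hasSum_exp (𝔸 := ℝ) s).mul_left (Real.exp (-s))
  rwa [← Real.exp_eq_exp_ℝ, ← Real.exp_add, neg_add_cancel, Real.exp_zero] at h

theorem poissonWeight_succ {s : ℝ} (hs : s ≠ 0) (n : ℕ) :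
    poissonWeight s (n + 1) * ((n + 1 : ℕ) / s) = poissonWeight s n := by
  unfold poissonWeight
  rw [Nat.factorial_succ]
  push_cast
  field_simp
  ring

theorem hasSum_poissonWeight_mul_div {s : ℝ} (hs : s ≠ 0) :
    HasSum (fun n => poissonWeight s n * (n / s)) 1 := by
  rw [← hasSum_nat_add_iff' 1]
  simpa only [poissonWeight_succ hs, Finset.sum_range_one, Nat.cast_zero, zero_div, mul_zero,
    sub_zero] using hasSum_poissonWeight s

theorem hasSum_poissonWeight_mul_div_sq {s : ℝ} (hs : s ≠ 0) :
    HasSum (fun n => poissonWeight s n * (n / s) ^ 2) (1 + 1 / s) := by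
  have h := (hasSum_poissonWeight_mul_div hs).add ((hasSum_poissonWeight s).mul_right (1 / s))
  rw [one_mul] at h
  rw [← hasSum_nat_add_iff' 1, Finset.sum_range_one, Nat.cast_zero, zero_div, zero_pow two_ne_zero,
    mul_zero, sub_zero]
  refine h.congr_fun fun n => ?_
  rw [pow_two, ← mul_assoc, poissonWeight_succ hs]
  push_cast
  ring

theorem hasSum_poissonWeight_mul_variance {s : ℝ} (hs : s ≠ 0) :
    HasSum (fun n => poissonWeight s n * (1 - n / s) ^ 2) (1 / s) := by
  have h := ((hasSum_poissonWeight s).add (hasSum_poissonWeight_mul_div_sq hs)).sub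
    ((hasSum_poissonWeight_mul_div hs).mul_left 2)
  rw [show 1 + (1 + 1 / s) - 2 * 1 = 1 / s by ring] at h
  exact h.congr_fun fun n => by ring

end PoissonWeight

section PowerBounded

variable {A : Type*} [NormedRing A] [NormedAlgebra ℝ A] [CompleteSpace A]

theorem hasSum_poissonWeight_smul_pow (K : A) (s : ℝ) :
    HasSum (fun n => poissonWeight s n • K ^ n) (NormedSpace.exp (-s • (1 - K))) := by
  have hexp : NormedSpace.exp (-s • (1 - K)) = Real.exp (-s) • NormedSpace.exp (s • K) := by
    let : NormedAlgebra ℚ A := NormedAlgebra.restrictScalars ℚ ℝ A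
    have hsplit : -s • (1 - K) = algebraMap ℝ A (-s) + s • K := by
      rw [Algebra.algebraMap_eq_smul_one]
      module
    rw [hsplit, NormedSpace.exp_add_of_commute (Algebra.commutes _ _),
      ← NormedSpace.algebraMap_exp_comm, ← Real.exp_eq_exp_ℝ, ← Algebra.smul_def]
  rw [hexp]
  convert (NormedSpace.exp_series_hasSum_exp' (𝕂 := ℝ) (s • K)).const_smul (Real.exp (-s))
    using 2 with n
  rw [poissonWeight, smul_pow, smul_smul, smul_smul]
  congr 1
  ring

theorem norm_exp_neg_smul_one_sub_le {K : A} {C : ℝ} (hK : ∀ n, ‖K ^ n‖ ≤ C) {s : ℝ}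
    (hs : 0 ≤ s) : ‖NormedSpace.exp (-s • (1 - K))‖ ≤ C := by
  refine (hasSum_poissonWeight_smul_pow K s).norm_le_of_bounded
    (by simpa using (hasSum_poissonWeight s).mul_right C) fun n => ?_
  rw [norm_smul, Real.norm_of_nonneg (poissonWeight_nonneg hs n)]
  exact mul_le_mul_of_nonneg_left (hK n) (poissonWeight_nonneg hs n)

theorem hasSum_poissonWeight_mul_smul_pow (K : A) {s : ℝ} (hs : s ≠ 0) :
    HasSum (fun n => (poissonWeight s n * (1 - n / s)) • K ^ n)
      ((1 - K) * NormedSpace.exp (-s • (1 - K))) := by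
  have hshift : HasSum (fun n => (poissonWeight s n * (n / s)) • K ^ n)
      (K * NormedSpace.exp (-s • (1 - K))) := by
    rw [← hasSum_nat_add_iff' 1]
    simpa only [poissonWeight_succ hs, Finset.sum_range_one, Nat.cast_zero, zero_div, mul_zero,
      zero_smul, sub_zero, mul_smul_comm, pow_succ']
      using (hasSum_poissonWeight_smul_pow K s).mul_left K
  simpa only [mul_sub, mul_one, sub_smul, sub_mul, one_mul]
    using (hasSum_poissonWeight_smul_pow K s).sub hshift

theorem abs_le_inv_sqrt_add_sqrt_mul_sq {s : ℝ} (hs : 0 < s) (d : ℝ) :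
    |d| ≤ (√s)⁻¹ / 2 + √s / 2 * d ^ 2 := by
  have := Real.sqrt_pos.2 hs
  have hsq : (√s)⁻¹ / 2 + √s / 2 * d ^ 2 - |d| = (√s)⁻¹ / 2 * (√s * |d| - 1) ^ 2 := by
    rw [← sq_abs d]
    field_simp
    ring
  rw [← sub_nonneg, hsq]
  positivity

-- The factor `1 / √s` is the standard deviation of `n / s` under the Poisson law.
theorem norm_one_sub_mul_exp_neg_smul_le {K : A} {C : ℝ} (hK : ∀ n, ‖K ^ n‖ ≤ C) {s : ℝ}
    (hs : 0 < s) : ‖(1 - K) * NormedSpace.exp (-s • (1 - K))‖ ≤ C / √s := by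
  have hsum := (((hasSum_poissonWeight s).mul_left ((√s)⁻¹ / 2)).add
    ((hasSum_poissonWeight_mul_variance hs.ne').mul_left (√s / 2))).mul_left C
  have hC : C * ((√s)⁻¹ / 2 * 1 + √s / 2 * (1 / s)) = C / √s := by
    have : √s * (1 / s) = (√s)⁻¹ := by rw [mul_one_div, Real.sqrt_div_self]
    rw [show √s / 2 * (1 / s) = √s * (1 / s) / 2 by ring, this]
    ring
  rw [hC] at hsum
  refine (hasSum_poissonWeight_mul_smul_pow K hs.ne').norm_le_of_bounded hsum fun n => ?_
  have hp := poissonWeight_nonneg hs.le n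
  rw [norm_smul, Real.norm_eq_abs, abs_mul, abs_of_nonneg hp]
  calc poissonWeight s n * |1 - n / s| * ‖K ^ n‖
      ≤ poissonWeight s n * ((√s)⁻¹ / 2 + √s / 2 * (1 - n / s) ^ 2) * C := by
        gcongr
        exacts [abs_le_inv_sqrt_add_sqrt_mul_sq hs _, hK n]
    _ = _ := by ring

theorem norm_exp_neg_smul_smul_one_sub_le {K : A} {C κ : ℝ} (hK : ∀ n, ‖K ^ n‖ ≤ C)
    (hκ : 0 ≤ κ) {s : ℝ} (hs : 0 ≤ s) : ‖NormedSpace.exp (-s • κ • (1 - K))‖ ≤ C := by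
  rw [smul_smul, neg_mul]
  exact norm_exp_neg_smul_one_sub_le hK (mul_nonneg hs hκ)

theorem norm_smul_one_sub_mul_exp_le {K : A} {C κ : ℝ} (hK : ∀ n, ‖K ^ n‖ ≤ C) (hκ : 0 < κ)
    {t : ℝ} (ht : 0 < t) :
    ‖κ • (1 - K) * NormedSpace.exp (-t • κ • (1 - K))‖ ≤ C * √(κ / t) := by
  rw [smul_mul_assoc, smul_smul, neg_mul, norm_smul, Real.norm_of_nonneg hκ.le]
  have hsqrt : κ / √(t * κ) = √(κ / t) := by
    rw [Real.sqrt_mul ht.le, Real.sqrt_div hκ.le, mul_comm, ← div_div, Real.div_sqrt]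
  calc κ * ‖(1 - K) * NormedSpace.exp (-(t * κ) • (1 - K))‖ ≤ κ * (C / √(t * κ)) :=
        mul_le_mul_of_nonneg_left (norm_one_sub_mul_exp_neg_smul_le hK (by positivity)) hκ.le
    _ = C * (κ / √(t * κ)) := by ring
    _ = C * √(κ / t) := by rw [hsqrt]

end PowerBounded

section StrongCoupling

theorem tendsto_inv_mul_of_le_mul_sqrt {g : ℝ → ℝ} {C c : ℝ} (hg : ∀ β, 0 ≤ g β)
    (hle : ∀ β, 0 ≤ β → g β ≤ C * √((1 + β) * c)) :
    Tendsto (fun β : ℝ => β⁻¹ * g β) atTop (𝓝 0) := by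
  have hinv : Tendsto (fun β : ℝ => β⁻¹) atTop (𝓝 0) := tendsto_inv_atTop_zero
  have hsqrt : Tendsto (fun β : ℝ => C * √(β⁻¹ * ((β⁻¹ + 1) * c))) atTop (𝓝 0) := by
    simpa using ((hinv.mul ((hinv.add_const 1).mul_const c)).sqrt).const_mul C
  refine squeeze_zero' ((eventually_ge_atTop 0).mono fun β hβ =>
    mul_nonneg (inv_nonneg.2 hβ) (hg β)) ?_ hsqrt
  filter_upwards [eventually_gt_atTop 0] with β hβ
  have hroot : √(β⁻¹ * ((β⁻¹ + 1) * c)) = β⁻¹ * √((1 + β) * c) := by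
    rw [show β⁻¹ * ((β⁻¹ + 1) * c) = β⁻¹ ^ 2 * ((1 + β) * c) by field_simp,
      Real.sqrt_mul (by positivity), Real.sqrt_sq (by positivity)]
  rw [hroot, mul_left_comm]
  gcongr
  exact hle β hβ.le

/-- The remainder `β * (f' + (L₀ + β L₁) f) = Q W` in the equation satisfied by the corrected
limit `f = W - β⁻¹ Z L₀ W`, where `W = exp (-s P L₀) P`. -/
def limitRemainder {A : Type*} [Ring A] (L₀ P Z : A) : A := Z * L₀ * P * L₀ - L₀ * Z * L₀

variable {A : Type*} [NormedRing A] [NormedAlgebra ℝ A]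

theorem commute_exp_neg_smul (x : A) (s : ℝ) : Commute x (NormedSpace.exp (-s • x)) :=
  ((Commute.refl x).smul_right (-s)).exp_right

theorem tendsto_exp_mul_one_sub {L₀ L₁ P Z : A} (hZ : 1 - P = L₁ * Z) {C t : ℝ}
    (hC : ∀ β : ℝ, 0 ≤ β → ‖NormedSpace.exp (-t • (L₀ + β • L₁))‖ ≤ C)
    (hdecay : Tendsto (fun β : ℝ =>
      β⁻¹ * ‖(L₀ + β • L₁) * NormedSpace.exp (-t • (L₀ + β • L₁))‖) atTop (𝓝 0)) :
    Tendsto (fun β : ℝ => NormedSpace.exp (-t • (L₀ + β • L₁)) * (1 - P)) atTop (𝓝 0) := by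
  have hfactor : ∀ β : ℝ, 0 < β → NormedSpace.exp (-t • (L₀ + β • L₁)) * (1 - P) =
      β⁻¹ • (((L₀ + β • L₁) * NormedSpace.exp (-t • (L₀ + β • L₁)) -
        NormedSpace.exp (-t • (L₀ + β • L₁)) * L₀) * Z) := by
    intro β hβ
    rw [hZ, (commute_exp_neg_smul (L₀ + β • L₁) t).eq, mul_add, add_sub_cancel_left,
      mul_smul_comm, smul_mul_assoc, inv_smul_smul₀ hβ.ne', mul_assoc]
  have hlim := (hdecay.add (tendsto_inv_atTop_zero.mul_const (C * ‖L₀‖))).mul_const ‖Z‖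
  rw [zero_mul, add_zero, zero_mul] at hlim
  refine squeeze_zero_norm' ?_ hlim
  filter_upwards [eventually_gt_atTop 0] with β hβ
  rw [hfactor β hβ, norm_smul, Real.norm_of_nonneg (inv_nonneg.2 hβ.le), ← mul_add, mul_assoc]
  gcongr
  refine (norm_mul_le _ _).trans (mul_le_mul_of_nonneg_right ?_ (norm_nonneg _))
  refine (norm_sub_le _ _).trans (add_le_add_right ((norm_mul_le _ _).trans ?_) _)
  gcongr
  exact hC β hβ.le

variable [CompleteSpace A]

theorem hasDerivAt_exp_neg_smul (x : A) (s : ℝ) :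
    HasDerivAt (fun r : ℝ => NormedSpace.exp (-r • x)) (-(x * NormedSpace.exp (-s • x))) s := by
  simpa only [smul_neg, neg_smul, neg_mul] using hasDerivAt_exp_smul_const' (𝕂 := ℝ) (-x) s

-- Duhamel's formula: `s ↦ exp (-(t - s) L) * f s` has derivative `exp (-(t - s) L) * r s`.
theorem norm_sub_exp_neg_smul_mul_le {L : A} {f r : ℝ → A} {C δ t : ℝ} (ht : 0 ≤ t)
    (hL : ∀ s : ℝ, 0 ≤ s → ‖NormedSpace.exp (-s • L)‖ ≤ C)
    (hf : ∀ s, HasDerivAt f (r s - L * f s) s) (hr : ∀ s ∈ Set.Icc 0 t, ‖r s‖ ≤ δ) :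
    ‖f t - NormedSpace.exp (-t • L) * f 0‖ ≤ C * δ * t := by
  have hderiv (s : ℝ) : HasDerivAt (fun s => NormedSpace.exp (-(t - s) • L) * f s)
      (NormedSpace.exp (-(t - s) • L) * r s) s := by
    have hexp := (hasDerivAt_exp_neg_smul L (t - s)).scomp s ((hasDerivAt_id s).const_sub t)
    refine (hexp.mul (hf s)).congr_deriv ?_
    rw [neg_smul, one_smul, neg_neg, (commute_exp_neg_smul L (t - s)).eq, Function.comp_apply,
      mul_sub, mul_assoc]
    abel
  have hbound : ∀ s ∈ Set.Ico 0 t, ‖NormedSpace.exp (-(t - s) • L) * r s‖ ≤ C * δ := by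
    intro s hs
    have hC := hL (t - s) (by linarith [hs.2])
    exact (norm_mul_le _ _).trans (mul_le_mul hC (hr s ⟨hs.1, hs.2.le⟩) (norm_nonneg _)
      ((norm_nonneg _).trans hC))
  simpa using norm_image_sub_le_of_norm_deriv_le_segment'
    (fun s _ => (hderiv s).hasDerivWithinAt) hbound t ⟨ht, le_rfl⟩

theorem hasDerivAt_exp_neg_smul_mul (x P : A) (s : ℝ) :
    HasDerivAt (fun r : ℝ => NormedSpace.exp (-r • x) * P)
      (-(x * (NormedSpace.exp (-s • x) * P))) s := by
  simpa only [neg_mul, mul_assoc] using (hasDerivAt_exp_neg_smul x s).mul_const P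

theorem mul_exp_neg_smul_mul_eq_zero {L₀ L₁ P : A} (hP : L₁ * P = 0) (s : ℝ) :
    L₁ * (NormedSpace.exp (-s • (P * L₀)) * P) = 0 := by
  let : NormedAlgebra ℚ A := NormedAlgebra.restrictScalars ℚ ℝ A
  have hsemi : SemiconjBy P (-s • (L₀ * P)) (-s • (P * L₀)) := by
    rw [SemiconjBy, mul_smul_comm, smul_mul_assoc, mul_assoc]
  rw [← hsemi.exp_right.eq, ← mul_assoc, hP, zero_mul]

theorem hasDerivAt_corrected_limit {L₀ L₁ P Z : A} (hP : L₁ * P = 0) (hZ : 1 - P = L₁ * Z)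
    {β : ℝ} (hβ : β ≠ 0) (s : ℝ) :
    HasDerivAt (fun s : ℝ => NormedSpace.exp (-s • (P * L₀)) * P -
        β⁻¹ • (Z * L₀ * (NormedSpace.exp (-s • (P * L₀)) * P)))
      (β⁻¹ • (limitRemainder L₀ P Z * (NormedSpace.exp (-s • (P * L₀)) * P)) -
        (L₀ + β • L₁) * (NormedSpace.exp (-s • (P * L₀)) * P -
          β⁻¹ • (Z * L₀ * (NormedSpace.exp (-s • (P * L₀)) * P)))) s := by
  have hW := hasDerivAt_exp_neg_smul_mul (P * L₀) P s
  have hL₁ := mul_exp_neg_smul_mul_eq_zero (L₀ := L₀) hP s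
  refine (hW.sub ((hW.const_mul (Z * L₀)).const_smul β⁻¹)).congr_deriv ?_
  generalize NormedSpace.exp (-s • (P * L₀)) * P = W at hL₁ ⊢
  have hL₁Z : L₁ * (Z * L₀ * W) = L₀ * W - P * L₀ * W := by
    rw [← mul_assoc, ← mul_assoc, ← hZ, sub_mul, sub_mul, one_mul]
  rw [mul_assoc, mul_assoc] at hL₁Z
  simp only [limitRemainder, add_mul, mul_sub, sub_mul, smul_mul_assoc, mul_smul_comm, hL₁, hL₁Z,
    smul_zero, smul_sub, inv_smul_smul₀ hβ, mul_neg, smul_neg, smul_add, mul_assoc]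
  abel

theorem norm_exp_mul_sub_exp_mul_le {L₀ L₁ P Z : A} (hP : L₁ * P = 0) (hZ : 1 - P = L₁ * Z)
    {B C β t : ℝ} (hβ : 0 < β) (ht : 0 ≤ t)
    (hC : ∀ s : ℝ, 0 ≤ s → ‖NormedSpace.exp (-s • (L₀ + β • L₁))‖ ≤ C)
    (hB : ∀ s ∈ Set.Icc 0 t,
      ‖limitRemainder L₀ P Z * (NormedSpace.exp (-s • (P * L₀)) * P)‖ ≤ B) :
    ‖NormedSpace.exp (-t • (L₀ + β • L₁)) * P - NormedSpace.exp (-t • (P * L₀)) * P‖ ≤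
      β⁻¹ * (C * B * t + ‖Z * L₀ * (NormedSpace.exp (-t • (P * L₀)) * P)‖ + C * ‖Z * L₀ * P‖) := by
  have hduhamel := norm_sub_exp_neg_smul_mul_le ht hC
    (hasDerivAt_corrected_limit (L₀ := L₀) hP hZ hβ.ne') (δ := β⁻¹ * B) fun s hs => by
      rw [norm_smul, Real.norm_of_nonneg (inv_nonneg.2 hβ.le)]
      exact mul_le_mul_of_nonneg_left (hB s hs) (inv_nonneg.2 hβ.le)
  simp only [neg_zero, zero_smul, NormedSpace.exp_zero, one_mul] at hduhamel
  have hU := hC t ht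
  set U := NormedSpace.exp (-t • (L₀ + β • L₁))
  set W := NormedSpace.exp (-t • (P * L₀)) * P
  have hcorr : ‖β⁻¹ • (U * (Z * L₀ * P) - Z * L₀ * W)‖ ≤
      β⁻¹ * (C * ‖Z * L₀ * P‖ + ‖Z * L₀ * W‖) := by
    rw [norm_smul, Real.norm_of_nonneg (inv_nonneg.2 hβ.le)]
    gcongr
    refine (norm_sub_le _ _).trans (add_le_add_left ((norm_mul_le _ _).trans ?_) _)
    gcongr
  calc ‖U * P - W‖
      = ‖-(W - β⁻¹ • (Z * L₀ * W) - U * (P - β⁻¹ • (Z * L₀ * P))) +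
          β⁻¹ • (U * (Z * L₀ * P) - Z * L₀ * W)‖ := by
        rw [mul_sub, mul_smul_comm, smul_sub]
        congr 1
        abel
    _ ≤ C * (β⁻¹ * B) * t + β⁻¹ * (C * ‖Z * L₀ * P‖ + ‖Z * L₀ * W‖) := by
        refine (norm_add_le _ _).trans (add_le_add ?_ hcorr)
        rwa [norm_neg]
    _ = _ := by ring

theorem tendsto_exp_mul_of_mul_eq_zero {L₀ L₁ P Z : A} (hP : L₁ * P = 0) (hZ : 1 - P = L₁ * Z)
    {C : ℝ} (hC : ∀ β : ℝ, 0 ≤ β → ∀ s : ℝ, 0 ≤ s → ‖NormedSpace.exp (-s • (L₀ + β • L₁))‖ ≤ C)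
    {t : ℝ} (ht : 0 ≤ t) :
    Tendsto (fun β : ℝ => NormedSpace.exp (-t • (L₀ + β • L₁)) * P) atTop
      (𝓝 (NormedSpace.exp (-t • (P * L₀)) * P)) := by
  have hcont : Continuous fun s : ℝ => NormedSpace.exp (-s • (P * L₀)) * P :=
    continuous_iff_continuousAt.2 fun s => (hasDerivAt_exp_neg_smul_mul (P * L₀) P s).continuousAt
  obtain ⟨B, hB⟩ := isCompact_Icc.exists_bound_of_continuousOn (s := Set.Icc 0 t)
    (hcont.const_mul (limitRemainder L₀ P Z)).continuousOn
  rw [tendsto_iff_norm_sub_tendsto_zero]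
  refine squeeze_zero' (Eventually.of_forall fun β => norm_nonneg _)
    ((eventually_gt_atTop 0).mono fun β hβ =>
      norm_exp_mul_sub_exp_mul_le hP hZ hβ ht (hC β hβ.le) hB) ?_
  simpa only [zero_mul] using tendsto_inv_atTop_zero.mul_const (C * B * t +
    ‖Z * L₀ * (NormedSpace.exp (-t • (P * L₀)) * P)‖ + C * ‖Z * L₀ * P‖)

theorem tendsto_exp_neg_smul_add_smul {L₀ L₁ P Z : A} (hP : L₁ * P = 0) (hZ : 1 - P = L₁ * Z)
    {C t : ℝ} (ht : 0 ≤ t)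
    (hC : ∀ β : ℝ, 0 ≤ β → ∀ s : ℝ, 0 ≤ s → ‖NormedSpace.exp (-s • (L₀ + β • L₁))‖ ≤ C)
    (hdecay : Tendsto (fun β : ℝ =>
      β⁻¹ * ‖(L₀ + β • L₁) * NormedSpace.exp (-t • (L₀ + β • L₁))‖) atTop (𝓝 0)) :
    Tendsto (fun β : ℝ => NormedSpace.exp (-t • (L₀ + β • L₁))) atTop
      (𝓝 (NormedSpace.exp (-t • (P * L₀)) * P)) := by
  simpa only [← mul_add, add_sub_cancel, mul_one, add_zero] using
    (tendsto_exp_mul_of_mul_eq_zero hP hZ hC ht).add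
      (tendsto_exp_mul_one_sub hZ (fun β hβ => hC β hβ t ht) hdecay)

end StrongCoupling

section RieszProjection

section Algebraic

variable {𝕜 A : Type*} [Field 𝕜] [Ring A] [Algebra 𝕜 A] {L P Z : A} {z c : 𝕜}

theorem algebraMap_sub_mul_resolvent (hz : z ∈ resolventSet 𝕜 L) :
    (algebraMap 𝕜 A z - L) * resolvent L z = 1 :=
  Ring.mul_inverse_cancel _ hz

theorem resolvent_mul_algebraMap_sub (hz : z ∈ resolventSet 𝕜 L) :
    resolvent L z * (algebraMap 𝕜 A z - L) = 1 :=
  Ring.inverse_mul_cancel _ hz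

theorem resolvent_mul_of_mul_eq_zero (hz : z ∈ resolventSet 𝕜 L) (hz0 : z ≠ 0)
    (hLP : L * P = 0) : resolvent L z * P = z⁻¹ • P := by
  have hP : (algebraMap 𝕜 A z - L) * (z⁻¹ • P) = P := by
    rw [mul_smul_comm, sub_mul, hLP, sub_zero, ← Algebra.smul_def, inv_smul_smul₀ hz0]
  conv_lhs => rw [← hP, ← mul_assoc, resolvent_mul_algebraMap_sub hz, one_mul]

theorem mul_resolvent_of_mul_eq_zero (hz : z ∈ resolventSet 𝕜 L) (hz0 : z ≠ 0)
    (hPL : P * L = 0) : P * resolvent L z = z⁻¹ • P := by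
  have hP : (z⁻¹ • P) * (algebraMap 𝕜 A z - L) = P := by
    rw [smul_mul_assoc, mul_sub, hPL, sub_zero, ← Algebra.commutes, ← Algebra.smul_def,
      inv_smul_smul₀ hz0]
  conv_lhs => rw [← hP, mul_assoc, algebraMap_sub_mul_resolvent hz, mul_one]

theorem algebraMap_sub_add_smul_mul_resolvent (hz : z ∈ resolventSet 𝕜 L) (hz0 : z ≠ 0)
    (hPP : IsIdempotentElem P) (hPL : P * L = 0) :
    (algebraMap 𝕜 A z - (L + c • P)) * (resolvent L z * (1 - P)) = 1 - P := by
  have hP : P * (resolvent L z * (1 - P)) = 0 := by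
    rw [← mul_assoc, mul_resolvent_of_mul_eq_zero hz hz0 hPL, smul_mul_assoc,
      hPP.mul_one_sub_self, smul_zero]
  rw [← sub_sub, sub_mul, smul_mul_assoc, hP, smul_zero, sub_zero, ← mul_assoc,
    algebraMap_sub_mul_resolvent hz, one_mul]

theorem mem_resolventSet_add_smul [IsDedekindFiniteMonoid A] (hz : z ∈ resolventSet 𝕜 L)
    (hz0 : z ≠ 0) (hzc : z ≠ c) (hPP : IsIdempotentElem P) (hLP : L * P = 0) (hPL : P * L = 0) :
    z ∈ resolventSet 𝕜 (L + c • P) := by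
  have hP : (algebraMap 𝕜 A z - (L + c • P)) * ((z - c)⁻¹ • P) = P := by
    rw [← sub_sub, mul_smul_comm, sub_mul, sub_mul, hLP, smul_mul_assoc, hPP.eq, sub_zero,
      ← Algebra.smul_def, ← sub_smul, inv_smul_smul₀ (sub_ne_zero.2 hzc)]
  refine IsUnit.of_mul_eq_one (resolvent L z * (1 - P) + (z - c)⁻¹ • P) ?_
  rw [mul_add, algebraMap_sub_add_smul_mul_resolvent hz hz0 hPP hPL, hP, sub_add_cancel]

theorem zero_mem_resolventSet_add_smul [IsDedekindFiniteMonoid A] (hc : c ≠ 0)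
    (hPP : IsIdempotentElem P) (hLP : L * P = 0) (hZ : 1 - P = L * Z) :
    0 ∈ resolventSet 𝕜 (L + c • P) := by
  have hP : (L + c • P) * (c⁻¹ • P) = P := by
    rw [mul_smul_comm, add_mul, hLP, zero_add, smul_mul_assoc, hPP.eq, inv_smul_smul₀ hc]
  have hQ : (L + c • P) * ((1 - P) * Z) = 1 - P := by
    rw [← mul_assoc, add_mul, mul_sub, hLP, smul_mul_assoc, hPP.mul_one_sub_self, smul_zero,
      add_zero, mul_one, sub_zero, hZ]
  refine IsUnit.of_mul_eq_one (-((1 - P) * Z + c⁻¹ • P)) ?_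
  rw [map_zero, zero_sub, neg_mul_neg, mul_add, hP, hQ, sub_add_cancel]

theorem resolvent_eq_inv_smul (hz : z ∈ resolventSet 𝕜 L) (hz0 : z ≠ 0)
    (hzc : z ∈ resolventSet 𝕜 (L + c • P)) (hPP : IsIdempotentElem P) (hLP : L * P = 0)
    (hPL : P * L = 0) :
    resolvent L z = z⁻¹ • (P + z • (resolvent (L + c • P) z * (1 - P))) := by
  have hQ : resolvent L z * (1 - P) = resolvent (L + c • P) z * (1 - P) := by
    conv_rhs => rw [← algebraMap_sub_add_smul_mul_resolvent (c := c) hz hz0 hPP hPL, ← mul_assoc,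
      resolvent_mul_algebraMap_sub hzc, one_mul]
  rw [← hQ, smul_add, inv_smul_smul₀ hz0, ← resolvent_mul_of_mul_eq_zero hz hz0 hLP, ← mul_add,
    add_sub_cancel, mul_one]

end Algebraic

-- `L + c • P` has no spectrum in the disc, so Cauchy's formula applies to
-- `z • resolvent L z = P + z • (resolvent (L + c • P) z * (1 - P))`, whose value at `0` is `P`.
theorem circleIntegral_resolvent {A : Type*} [NormedRing A] [NormedAlgebra ℂ A] [CompleteSpace A]
    [IsDedekindFiniteMonoid A] {L P Z : A} {ε : ℝ} (hε : 0 < ε)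
    (hL : Metric.closedBall (0 : ℂ) ε ∩ spectrum ℂ L ⊆ {0}) (hPP : IsIdempotentElem P)
    (hLP : L * P = 0) (hPL : P * L = 0) (hZ : 1 - P = L * Z) :
    (∮ z in C(0, ε), resolvent L z) = (2 * Real.pi * Complex.I : ℂ) • P := by
  obtain ⟨c, hc⟩ : ∃ c : ℂ, c ∉ Metric.closedBall (0 : ℂ) ε := by
    refine ⟨((ε + 1 : ℝ) : ℂ), fun h => ?_⟩
    rw [mem_closedBall_zero_iff, Complex.norm_real, Real.norm_of_nonneg (by positivity)] at h
    linarith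
  have hc0 : c ≠ 0 := by
    rintro rfl
    exact hc (Metric.mem_closedBall_self hε.le)
  have hmem : ∀ z ∈ Metric.closedBall (0 : ℂ) ε, z ≠ 0 → z ∈ resolventSet ℂ L :=
    fun z hz hz0 => not_not.1 fun h => hz0 (hL ⟨hz, h⟩)
  have hmem' : ∀ z ∈ Metric.closedBall (0 : ℂ) ε, z ∈ resolventSet ℂ (L + c • P) := by
    intro z hz
    obtain rfl | hz0 := eq_or_ne z 0
    · exact zero_mem_resolventSet_add_smul hc0 hPP hLP hZ
    · exact mem_resolventSet_add_smul (hmem z hz hz0) hz0 (ne_of_mem_of_not_mem hz hc) hPP hLP hPL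
  have hdiff : DifferentiableOn ℂ (fun z : ℂ => P + z • (resolvent (L + c • P) z * (1 - P)))
      (Metric.closedBall 0 ε) := fun z hz =>
    ((differentiableAt_id.smul ((spectrum.hasDerivAt_resolvent_const_left
      (hmem' z hz)).differentiableAt.mul_const _)).const_add P).differentiableWithinAt
  have hcauchy := hdiff.diffContOnCl_ball le_rfl |>.circleIntegral_sub_inv_smul
    (Metric.mem_ball_self hε)
  rw [zero_smul, add_zero] at hcauchy
  rw [← hcauchy]
  refine circleIntegral.integral_congr hε.le fun z hz => ?_
  have hball := Metric.sphere_subset_closedBall hz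
  have hz0 : z ≠ 0 := Metric.ne_of_mem_sphere hz hε.ne'
  simpa only [sub_zero] using
    resolvent_eq_inv_smul (hmem z hball hz0) hz0 (hmem' z hball) hPP hLP hPL

theorem rieszProjection_eq {E : Type*} [NormedAddCommGroup E] [NormedSpace ℂ E]
    [FiniteDimensional ℂ E] {L P Z : E →L[ℂ] E} (hPP : IsIdempotentElem P) (hLP : L * P = 0)
    (hPL : P * L = 0) (hZ : 1 - P = L * Z) : rieszProjection L = P := by
  have : CompleteSpace E := FiniteDimensional.complete ℂ E
  have : IsArtinianRing (E →L[ℂ] E) := IsArtinianRing.of_finite ℂ _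
  obtain ⟨hε, hL⟩ := (exists_isolating_radius L).choose_spec
  rw [rieszProjection, circleIntegral_resolvent hε hL hPP hLP hPL hZ,
    inv_smul_smul₀ Complex.two_pi_I_ne_zero]

end RieszProjection

section RootedMaps

variable {α : Type*}

/-- `g` is the parent map of a spanning tree on `α` rooted at `i`: it fixes the root, and all its
orbits run into the root. -/
def IsRootedMap (i : α) (g : α → α) : Prop := g i = i ∧ ∀ v, ∃ n, g^[n] v = i

/-- `g` is the parent map of a spanning unicyclic graph on `α` whose cycle passes through `x` and
is not a loop. -/
def IsUnicyclicMap (x : α) (g : α → α) : Prop := g x ≠ x ∧ ∀ v, ∃ n, g^[n] v = x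

theorem exists_rank_of_reachable {r : α → α → Prop} {i : α}
    (h : ∀ v, Relation.ReflTransGen r i v) :
    ∃ rank : α → ℕ, ∀ v, v ≠ i → ∃ u, r u v ∧ rank u < rank v := by
  classical
  set level : ℕ → Set α := fun n => (fun S => {v | ∃ u ∈ S, r u v})^[n] {i}
  have hsucc (n : ℕ) : level (n + 1) = {v | ∃ u ∈ level n, r u v} :=
    Function.iterate_succ_apply' _ _ _
  have hmem (v : α) : ∃ n, v ∈ level n := by
    induction h v with
    | refl => exact ⟨0, rfl⟩
    | tail _ hr ih =>
      obtain ⟨n, hn⟩ := ih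
      exact ⟨n + 1, hsucc n ▸ ⟨_, hn, hr⟩⟩
  refine ⟨fun v => Nat.find (hmem v), fun v hv => ?_⟩
  have hspec := Nat.find_spec (hmem v)
  rcases hn : Nat.find (hmem v) with _ | n
  · rw [hn] at hspec
    exact absurd hspec hv
  · rw [hn, hsucc] at hspec
    obtain ⟨u, hu, hr⟩ := hspec
    refine ⟨u, hr, ?_⟩
    simp only [hn]
    exact Nat.lt_succ_of_le (Nat.find_min' (hmem u) hu)

theorem exists_isRootedMap {r : α → α → Prop} {i : α} (h : ∀ v, Relation.ReflTransGen r i v) :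
    ∃ g : α → α, IsRootedMap i g ∧ ∀ v, v ≠ i → r (g v) v := by
  classical
  obtain ⟨rank, hrank⟩ := exists_rank_of_reachable h
  choose p hpr hlt using hrank
  refine ⟨fun v => if hv : v = i then i else p v hv, ⟨dif_pos rfl, fun v => ?_⟩, fun v hv => ?_⟩
  · induction hn : rank v using Nat.strong_induction_on generalizing v with
    | _ n ih =>
      by_cases hv : v = i
      · exact ⟨0, hv⟩
      · obtain ⟨k, hk⟩ := ih _ (hn ▸ hlt v hv) (p v hv) rfl
        exact ⟨k + 1, by rw [Function.iterate_succ_apply, dif_neg hv, hk]⟩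
  · simpa only [dif_neg hv] using hpr v hv

theorem exists_iterate_update_eq [DecidableEq α] {f : α → α} {z c v : α}
    (h : ∃ n, f^[n] v = z) : ∃ n, (Function.update f z c)^[n] v = z := by
  obtain ⟨n, hn⟩ := h
  induction n generalizing v with
  | zero => exact ⟨0, hn⟩
  | succ n ih =>
    by_cases hv : v = z
    · exact ⟨0, hv⟩
    · obtain ⟨k, hk⟩ := ih (v := f v) hn
      exact ⟨k + 1, by rwa [Function.iterate_succ_apply, Function.update_of_ne hv]⟩

theorem mem_periodicPts_of_map_eq {h : α → α} {x a : α} (ha : h a = x)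
    (hxa : ∃ n, h^[n] x = a) : a ∈ Function.periodicPts h := by
  obtain ⟨n, rfl⟩ := hxa
  refine ⟨n + 1, n.succ_pos, ?_⟩
  rw [Function.IsPeriodicPt, Function.IsFixedPt, Function.iterate_succ_apply, ha]

theorem eq_of_map_eq_of_exists_iterate {h : α → α} {x a b : α} (ha : h a = x) (hb : h b = x)
    (hxa : ∃ n, h^[n] x = a) (hxb : ∃ n, h^[n] x = b) : a = b :=
  (Function.bijOn_periodicPts h).injOn (mem_periodicPts_of_map_eq ha hxa)
    (mem_periodicPts_of_map_eq hb hxb) (ha.trans hb.symm)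

section Update

variable [DecidableEq α]

theorem IsRootedMap.isUnicyclicMap_update {x y : α} {g : α → α} (hg : IsRootedMap x g)
    (hy : y ≠ x) : IsUnicyclicMap x (Function.update g x y) :=
  ⟨by rwa [Function.update_self], fun v => exists_iterate_update_eq (hg.2 v)⟩

theorem IsUnicyclicMap.isRootedMap_update {x : α} {h : α → α} (hh : IsUnicyclicMap x h) :
    IsRootedMap x (Function.update h x x) :=
  ⟨Function.update_self .., fun v => exists_iterate_update_eq (hh.2 v)⟩

theorem IsRootedMap.update_self {i : α} {g : α → α} (hg : IsRootedMap i g) :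
    Function.update g i i = g :=
  Function.update_eq_self_iff.2 hg.1.symm

theorem IsRootedMap.isUnicyclicMap_update_of_ne {x z : α} {g : α → α} (hg : IsRootedMap z g)
    (hz : z ≠ x) : IsUnicyclicMap x (Function.update g z x) := by
  constructor
  · rw [Function.update_of_ne hz.symm]
    intro hx
    obtain ⟨n, hn⟩ := hg.2 x
    exact hz (hn.symm.trans (Function.iterate_fixed hx n))
  · intro v
    obtain ⟨n, hn⟩ := exists_iterate_update_eq (c := x) (hg.2 v)
    exact ⟨n + 1, by rw [Function.iterate_succ_apply', hn, Function.update_self]⟩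

theorem IsUnicyclicMap.exists_isRootedMap_update {x : α} {h : α → α} (hh : IsUnicyclicMap x h) :
    ∃ z, z ≠ x ∧ h z = x ∧ IsRootedMap z (Function.update h z z) := by
  obtain ⟨n, hn⟩ := hh.2 (h x)
  have hz : h (h^[n] x) = x := by
    rw [← Function.iterate_succ_apply' h, Function.iterate_succ_apply, hn]
  refine ⟨h^[n] x, fun h0 => hh.1 (by rwa [h0] at hz), hz, Function.update_self .., fun v =>
    exists_iterate_update_eq ?_⟩
  obtain ⟨k, hk⟩ := hh.2 v
  exact ⟨n + k, by rw [Function.iterate_add_apply, hk]⟩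

theorem IsRootedMap.eq_of_update_eq {x z z' : α} {g g' : α → α} (hg : IsRootedMap z g)
    (hg' : IsRootedMap z' g') (h : Function.update g z x = Function.update g' z' x) :
    z = z' ∧ g = g' := by
  have hz : z = z' := by
    refine eq_of_map_eq_of_exists_iterate (h := Function.update g z x) (x := x)
      (Function.update_self ..) ?_ (exists_iterate_update_eq (hg.2 x)) ?_
    · rw [h, Function.update_self]
    · exact h ▸ exists_iterate_update_eq (hg'.2 x)
  subst hz
  refine ⟨rfl, ?_⟩
  rw [← hg.update_self, ← hg'.update_self, ← Function.update_idem (a := z) x z g, h,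
    Function.update_idem]

end Update

section TreeSum

variable [Fintype α] {R : Type*} [CommSemiring R]

open Classical in
/-- The sum of the weights of all spanning trees on `α` rooted at `i`. -/
noncomputable def treeSum (w : α → α → R) (i : α) : R :=
  ∑ g : α → α with IsRootedMap i g, ∏ v ∈ Finset.univ.erase i, w v (g v)

theorem mul_prod_erase_eq_prod_update [DecidableEq α] (w : α → α → R) (g : α → α) (x y : α) :
    w x y * ∏ v ∈ Finset.univ.erase x, w v (g v) = ∏ v, w v (Function.update g x y v) := by
  rw [← Finset.mul_prod_erase _ _ (Finset.mem_univ x), Function.update_self]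
  congr 1
  refine Finset.prod_congr rfl fun v hv => ?_
  rw [Function.update_of_ne (Finset.ne_of_mem_erase hv)]

open Classical in
theorem sum_mul_treeSum_eq_sum_isUnicyclicMap (w : α → α → R) (x : α) :
    (∑ y ∈ Finset.univ.erase x, w x y) * treeSum w x =
      ∑ h : α → α with IsUnicyclicMap x h, ∏ v, w v (h v) := by
  rw [treeSum, Finset.sum_mul_sum, ← Finset.sum_product']
  refine Finset.sum_bij' (fun p _ => Function.update p.2 x p.1)
    (fun h _ => (h x, Function.update h x x)) ?_ ?_ ?_ ?_ ?_
  all_goals simp only [Finset.mem_product, Finset.mem_erase, Finset.mem_univ, and_true,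
    Finset.mem_filter, true_and]
  · exact fun p hp => hp.2.isUnicyclicMap_update hp.1
  · exact fun h hh => ⟨hh.1, hh.isRootedMap_update⟩
  · intro p hp
    rw [Function.update_idem, hp.2.update_self, Function.update_self]
  · intro h _
    rw [Function.update_idem, Function.update_eq_self]
  · exact fun p _ => mul_prod_erase_eq_prod_update w p.2 x p.1

open Classical in
theorem sum_treeSum_eq_sum_isUnicyclicMap (w : α → α → R) (x : α) :
    ∑ z ∈ Finset.univ.erase x, w z x * treeSum w z =
      ∑ h : α → α with IsUnicyclicMap x h, ∏ v, w v (h v) := by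
  simp only [treeSum, Finset.mul_sum]
  rw [Finset.sum_sigma']
  refine Finset.sum_bij (fun p _ => Function.update p.2 p.1 x) ?_ ?_ ?_ ?_
  all_goals simp only [Finset.mem_sigma, Finset.mem_erase, Finset.mem_univ, and_true,
    Finset.mem_filter, true_and]
  · exact fun p hp => hp.2.isUnicyclicMap_update_of_ne hp.1
  · rintro ⟨z, g⟩ hp ⟨z', g'⟩ hp' h
    obtain ⟨rfl, rfl⟩ := hp.2.eq_of_update_eq hp'.2 h
    rfl
  · intro h hh
    obtain ⟨z, hzx, hz, hroot⟩ := hh.exists_isRootedMap_update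
    refine ⟨⟨z, Function.update h z z⟩, ⟨hzx, hroot⟩, ?_⟩
    rw [Function.update_idem, ← hz, Function.update_eq_self]
  · exact fun p _ => mul_prod_erase_eq_prod_update w p.2 p.1 x

-- The Markov chain tree theorem. Both sides, without the loops at `x`, count unicyclic graphs:
-- the cycle is cut at the edge leaving `x`, respectively at the edge entering `x`.
theorem sum_mul_treeSum (w : α → α → R) (x : α) :
    (∑ y, w x y) * treeSum w x = ∑ z, w z x * treeSum w z := by
  classical
  rw [← Finset.add_sum_erase _ _ (Finset.mem_univ x), add_mul,
    sum_mul_treeSum_eq_sum_isUnicyclicMap, ← sum_treeSum_eq_sum_isUnicyclicMap,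
    Finset.add_sum_erase _ (fun z => w z x * treeSum w z) (Finset.mem_univ x)]

end TreeSum

end RootedMaps

section Reaches

variable {V : Type*} {T : Set (V × V)}

theorem mem_reachableFrom_self (T : Set (V × V)) (u : V) : u ∈ reachableFrom T u :=
  Relation.ReflTransGen.refl

theorem reachableFrom_subset {u v : V} (h : v ∈ reachableFrom T u) :
    reachableFrom T v ⊆ reachableFrom T u := fun _ hw => Relation.ReflTransGen.trans h hw

/-- `u` is a root of the reach `R`: every node of `R` can be reached from `u`. -/
def Reach.IsRoot (R : Reach T) (u : V) : Prop := R.1 = reachableFrom T u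

theorem Reach.exists_isRoot (R : Reach T) : ∃ u, R.IsRoot u := R.2.prop

/-- A chosen root of a reach. -/
noncomputable def Reach.root (R : Reach T) : V := R.exists_isRoot.choose

theorem Reach.isRoot_root (R : Reach T) : R.IsRoot R.root := R.exists_isRoot.choose_spec

theorem Reach.IsRoot.mem {R : Reach T} {u : V} (h : R.IsRoot u) : u ∈ R.1 :=
  h.ge (mem_reachableFrom_self T u)

theorem Reach.mem_of_reachable {R : Reach T} {u v : V} (hu : u ∈ R.1)
    (h : v ∈ reachableFrom T u) : v ∈ R.1 := by
  rw [R.isRoot_root] at hu ⊢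
  exact reachableFrom_subset hu h

theorem Reach.isRoot_of_subset {R : Reach T} {u : V} (h : R.1 ⊆ reachableFrom T u) : R.IsRoot u :=
  R.2.eq_of_le ⟨u, rfl⟩ h

theorem Reach.IsRoot.of_reachable {R : Reach T} {u v : V} (hu : R.IsRoot u)
    (h : u ∈ reachableFrom T v) : R.IsRoot v :=
  Reach.isRoot_of_subset (hu.le.trans (reachableFrom_subset h))

theorem Reach.IsRoot.eq_of_mem {R S : Reach T} {u : V} (hu : R.IsRoot u) (h : u ∈ S.1) :
    S = R := by
  refine Subtype.ext (R.2.eq_of_le S.2.prop ?_).symm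
  rw [hu]
  exact fun v hv => Reach.mem_of_reachable h hv

theorem Reach.IsRoot.mem_exclusivePart {R : Reach T} {u : V} (hu : R.IsRoot u) :
    u ∈ exclusivePart T R :=
  ⟨hu.mem, fun _ hS h => hS (hu.eq_of_mem h)⟩

theorem exists_reach_mem [Finite V] (T : Set (V × V)) (v : V) : ∃ R : Reach T, v ∈ R.1 := by
  obtain ⟨R, hR, hmax⟩ := Finite.exists_le_maximal
    (p := fun S : Set V => ∃ u, S = reachableFrom T u) (a := reachableFrom T v) ⟨v, rfl⟩
  exact ⟨⟨R, hmax⟩, hR (mem_reachableFrom_self T v)⟩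

theorem notMem_commonPart_of_mem_exclusivePart {R : Reach T} {v : V}
    (h : v ∈ exclusivePart T R) : v ∉ commonPart T R :=
  fun ⟨_, S, hS, hv⟩ => h.2 S hS hv

theorem Reach.root_notMem_commonPart (S R : Reach T) : S.root ∉ commonPart T R := fun h =>
  notMem_commonPart_of_mem_exclusivePart
    (S.isRoot_root.eq_of_mem h.1 ▸ S.isRoot_root.mem_exclusivePart) h

theorem mem_exclusivePart_or_mem_commonPart {R : Reach T} {v : V} (h : v ∈ R.1) :
    v ∈ exclusivePart T R ∨ v ∈ commonPart T R := by
  by_cases h' : ∃ S : Reach T, S ≠ R ∧ v ∈ S.1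
  · exact Or.inr ⟨h, h'⟩
  · exact Or.inl ⟨h, fun S hS hv => h' ⟨S, hS, hv⟩⟩

theorem mem_exclusivePart_of_edge [Finite V] {R : Reach T} {u v : V} (h : EdgeFromTo T u v)
    (hv : v ∈ exclusivePart T R) : u ∈ exclusivePart T R := by
  have eq_of_mem (S : Reach T) (hS : u ∈ S.1) : S = R := by
    by_contra hne
    exact hv.2 S hne (Reach.mem_of_reachable hS (Relation.ReflTransGen.single h))
  obtain ⟨S, hS⟩ := exists_reach_mem T u
  exact ⟨eq_of_mem S hS ▸ hS, fun S hne hS => hne (eq_of_mem S hS)⟩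

end Reaches

section ParentEdges

variable {V : Type*} {R : Set V}

open Classical in
/-- The edges from the parent `g v` to `v`, for all `v ∈ R` other than the root `i`. -/
noncomputable def parentEdges [Fintype R] (i : R) (g : R → R) : Finset (V × V) :=
  (Finset.univ.erase i).image fun v => (v.1, (g v).1)

theorem mem_parentEdges [Fintype R] {i : R} {g : R → R} {e : V × V} :
    e ∈ parentEdges i g ↔ ∃ v : R, v ≠ i ∧ (v.1, (g v).1) = e := by
  simp only [parentEdges, Finset.mem_image, Finset.mem_erase, Finset.mem_univ, and_true]

theorem prod_parentEdges [Fintype R] [DecidableEq R] {M : Type*} [CommMonoid M] (f : V × V → M)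
    (i : R) (g : R → R) :
    ∏ e ∈ parentEdges i g, f e = ∏ v ∈ Finset.univ.erase i, f (v.1, (g v).1) := by
  classical
  rw [parentEdges, Finset.prod_image fun v _ v' _ h => Subtype.ext (congrArg Prod.fst h)]
  congr!

theorem IsRootedMap.eq_of_parentEdges_eq [Fintype R] {i : R} {g g' : R → R}
    (hg : IsRootedMap i g) (hg' : IsRootedMap i g') (h : parentEdges i g = parentEdges i g') :
    g = g' := by
  funext v
  by_cases hv : v = i
  · rw [hv, hg.1, hg'.1]
  · obtain ⟨v', -, he⟩ := mem_parentEdges.1 (h ▸ mem_parentEdges.2 ⟨v, hv, rfl⟩)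
    obtain ⟨hvv', hgv⟩ := Prod.mk.inj he
    rw [Subtype.ext hvv'] at hgv
    exact Subtype.ext hgv.symm

theorem IsRootedMap.isSpanningTree_parentEdges [Fintype R] {T : Set (V × V)} {i : R} {g : R → R}
    (hg : IsRootedMap i g) (hT : ∀ v, v ≠ i → (v.1, (g v).1) ∈ T) :
    IsSpanningTree T R i (parentEdges i g) := by
  refine ⟨i.2, fun e he => ?_, fun e he hei => ?_, fun v hv hvi => ?_, fun v hv => ?_⟩
  · obtain ⟨v, hv, rfl⟩ := mem_parentEdges.1 he
    exact ⟨hT v hv, v.2, (g v).2⟩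
  · obtain ⟨v, hv, rfl⟩ := mem_parentEdges.1 he
    exact hv (Subtype.ext hei)
  · refine ⟨g ⟨v, hv⟩, mem_parentEdges.2 ⟨⟨v, hv⟩, fun h => hvi (congrArg Subtype.val h), rfl⟩,
      fun u hu => ?_⟩
    obtain ⟨v', -, he⟩ := mem_parentEdges.1 hu
    obtain ⟨rfl, rfl⟩ := Prod.mk.inj he
    rfl
  · lift v to R using hv
    obtain ⟨n, hn⟩ := hg.2 v
    induction n generalizing v with
    | zero => exact hn ▸ Relation.ReflTransGen.refl
    | succ n ih =>
      by_cases hvi : v = i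
      · exact hvi ▸ Relation.ReflTransGen.refl
      · exact (ih (g v) hn).tail (mem_parentEdges.2 ⟨v, hvi, rfl⟩)

theorem isRootedMap_of_isSpanningTree {T : Set (V × V)} {B : Finset (V × V)} {i : R} {g : R → R}
    (hB : IsSpanningTree T R i B) (hgi : g i = i) (hg : ∀ v, v ≠ i → (v.1, (g v).1) ∈ B) :
    IsRootedMap i g := by
  obtain ⟨-, hmem, hroot, huniq, hreach⟩ := hB
  have exists_iterate {v : V} (h : Relation.ReflTransGen (EdgeFromTo (B : Set (V × V))) i v) :
      ∀ hv : v ∈ R, ∃ n, g^[n] ⟨v, hv⟩ = i := by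
    induction h with
    | refl => exact fun _ => ⟨0, rfl⟩
    | @tail b c _ hbc ih =>
      intro hc
      have hbc : (c, b) ∈ B := hbc
      obtain ⟨n, hn⟩ := ih (hmem _ hbc).2.2
      have hci : c ≠ i := hroot _ hbc
      have hgc : (g ⟨c, hc⟩).1 = b :=
        (huniq c hc hci).unique (hg ⟨c, hc⟩ fun h => hci (congrArg Subtype.val h)) hbc
      refine ⟨n + 1, ?_⟩
      rw [Function.iterate_succ_apply, ← hn]
      exact congrArg _ (Subtype.ext hgc)
  exact ⟨hgi, fun v => exists_iterate (hreach v v.2) v.2⟩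

theorem IsSpanningTree.exists_parentEdges_eq [Fintype R] {T : Set (V × V)} {B : Finset (V × V)}
    {i : R} (hB : IsSpanningTree T R i B) :
    ∃ g : R → R, IsRootedMap i g ∧ (∀ v, v ≠ i → (v.1, (g v).1) ∈ T) ∧ parentEdges i g = B := by
  classical
  obtain ⟨-, hmem, hroot, huniq, -⟩ := id hB
  have hparent (v : R) (hv : v ≠ i) : ∃ u : R, (v.1, u.1) ∈ B := by
    obtain ⟨u, hu, -⟩ := huniq v v.2 fun h => hv (Subtype.ext h)
    exact ⟨⟨u, (hmem _ hu).2.2⟩, hu⟩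
  choose p hp using hparent
  set g : R → R := fun v => if hv : v = i then i else p v hv with hg
  have hgB (v : R) (hv : v ≠ i) : (v.1, (g v).1) ∈ B := by
    simpa only [hg, dif_neg hv] using hp v hv
  refine ⟨g, isRootedMap_of_isSpanningTree hB (dif_pos rfl) hgB, fun v hv => (hmem _ (hgB v hv)).1,
    ?_⟩
  ext ⟨c, b⟩
  rw [mem_parentEdges]
  constructor
  · rintro ⟨v, hv, he⟩
    exact he ▸ hgB v hv
  · intro he
    have hci : c ≠ i := hroot _ he
    have hc : (⟨c, (hmem _ he).2.1⟩ : R) ≠ i := fun h => hci (congrArg Subtype.val h)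
    exact ⟨_, hc, Prod.ext rfl ((huniq c (hmem _ he).2.1 hci).unique (hgB _ hc) he)⟩

theorem Reach.IsRoot.exists_isSpanningTree [Finite V] {T : Set (V × V)} {R : Reach T} {i : V}
    (hi : R.IsRoot i) : ∃ B, IsSpanningTree T R.1 i B := by
  have := Fintype.ofFinite R.1
  have hreach {v : V} (h : Relation.ReflTransGen (EdgeFromTo T) i v) : ∀ hv : v ∈ R.1,
      Relation.ReflTransGen (fun u v : R.1 => EdgeFromTo T u.1 v.1) ⟨i, hi.mem⟩ ⟨v, hv⟩ := by
    induction h with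
    | refl => exact fun _ => Relation.ReflTransGen.refl
    | tail hb hbc ih => exact fun _ => (ih (Reach.mem_of_reachable hi.mem hb)).tail hbc
  obtain ⟨g, hg, hgT⟩ := exists_isRootedMap fun v : R.1 => hreach (hi.le v.2) v.2
  exact ⟨_, hg.isSpanningTree_parentEdges hgT⟩

end ParentEdges

section WeightVector

variable {V : Type*} [Fintype V] {w : V → V → ℝ} {T : Set (V × V)} {R : Reach T}

theorem weightVector_eq_treeSum [Fintype R.1] (hT : ∀ x y, (x, y) ∉ T → w x y = 0) (i : R.1) :
    weightVector w T R i = treeSum (fun x y : R.1 => w x y) i := by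
  classical
  have edge_mem (g : R.1 → R.1) (hg : ∏ v ∈ Finset.univ.erase i, w v (g v) ≠ 0) (v : R.1)
      (hv : v ≠ i) : (v.1, (g v).1) ∈ T := by
    by_contra hvT
    exact hg (Finset.prod_eq_zero (Finset.mem_erase.2 ⟨hv, Finset.mem_univ v⟩) (hT _ _ hvT))
  have htree : treeSum (fun x y : R.1 => w x y) i =
      ∑ g : R.1 → R.1 with IsRootedMap i g ∧ ∀ v, v ≠ i → (v.1, (g v).1) ∈ T,
        ∏ v ∈ Finset.univ.erase i, w v (g v) := by
    rw [treeSum, ← Finset.filter_filter, Finset.sum_filter_of_ne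
      (p := fun g : R.1 → R.1 => ∀ v, v ≠ i → (v.1, (g v).1) ∈ T) fun g _ hg => edge_mem g ?_]
    · congr!
    · convert hg
  rw [htree, weightVector]
  symm
  refine Finset.sum_bij (fun g _ => parentEdges i g) ?_ ?_ ?_ ?_
  all_goals simp only [Finset.mem_filter, Finset.mem_univ, true_and]
  · exact fun g hg => hg.1.isSpanningTree_parentEdges hg.2
  · exact fun g hg g' hg' h => hg.1.eq_of_parentEdges_eq hg'.1 h
  · intro B hB
    obtain ⟨g, hg, hgT, rfl⟩ := hB.exists_parentEdges_eq
    exact ⟨g, ⟨hg, hgT⟩, rfl⟩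
  · exact fun g _ => (prod_parentEdges (fun e => w e.1 e.2) i g).symm

theorem weightVector_congr {w' : V → V → ℝ} (h : ∀ x y, (x, y) ∈ T → w x y = w' x y) (i : V) :
    weightVector w T R i = weightVector w' T R i := by
  classical
  refine Finset.sum_congr rfl fun B hB => Finset.prod_congr rfl fun e he => h e.1 e.2 ?_
  exact ((Finset.mem_filter.1 hB).2.2.1 e he).1

theorem weightVector_nonneg (hw : ∀ x y, 0 ≤ w x y) (i : V) : 0 ≤ weightVector w T R i :=
  Finset.sum_nonneg fun _ _ => Finset.prod_nonneg fun _ _ => hw _ _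

theorem isRoot_of_weightVector_ne_zero {i : V} (h : weightVector w T R i ≠ 0) : R.IsRoot i := by
  classical
  obtain ⟨B, hB, -⟩ := Finset.exists_ne_zero_of_sum_ne_zero h
  obtain ⟨-, hmem, -, -, hreach⟩ := (Finset.mem_filter.1 hB).2
  exact Reach.isRoot_of_subset fun v hv => Relation.ReflTransGen.mono
    (fun u v huv => (hmem (v, u) huv).1) _ _ (hreach v hv)

theorem Reach.IsRoot.weightVector_pos (hw : ∀ x y, 0 ≤ w x y) (hT : ∀ x y, (x, y) ∈ T → 0 < w x y)
    {i : V} (hi : R.IsRoot i) : 0 < weightVector w T R i := by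
  classical
  obtain ⟨B, hB⟩ := hi.exists_isSpanningTree
  exact Finset.sum_pos' (fun _ _ => Finset.prod_nonneg fun _ _ => hw _ _)
    ⟨B, Finset.mem_filter.2 ⟨Finset.mem_univ B, hB⟩,
      Finset.prod_pos fun e he => hT e.1 e.2 (hB.2.1 e he).1⟩

theorem sum_mul_weightVector (hT : ∀ x y, (x, y) ∉ T → w x y = 0) (x : V) :
    (∑ y, w x y) * weightVector w T R x = ∑ z, w z x * weightVector w T R z := by
  classical
  have mem_of_ne_zero {x y : V} (h : w x y ≠ 0) : EdgeFromTo T y x :=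
    not_not.1 fun hxy => h (hT x y hxy)
  have isRoot_of_edge {x y : V} (h : w x y ≠ 0) (hx : R.IsRoot x) : R.IsRoot y :=
    hx.of_reachable (Relation.ReflTransGen.single (mem_of_ne_zero h))
  have sum_eq {f : V → ℝ} (hf : ∀ y, f y ≠ 0 → y ∈ R.1) : ∑ y : R.1, f y = ∑ y, f y :=
    Fintype.sum_of_injective _ Subtype.val_injective _ _
      (fun y hy => not_not.1 fun h => hy ⟨⟨y, hf y h⟩, rfl⟩) fun _ => rfl
  by_cases hx : R.IsRoot x
  · have htree := sum_mul_treeSum (fun x y : R.1 => w x y) ⟨x, hx.mem⟩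
    simp only [← weightVector_eq_treeSum hT] at htree
    rwa [sum_eq fun y hy => (isRoot_of_edge hy hx).mem,
      sum_eq (f := fun z => w z x * weightVector w T R z) fun z hz =>
        (isRoot_of_weightVector_ne_zero (right_ne_zero_of_mul hz)).mem] at htree
  · rw [not_not.1 (mt isRoot_of_weightVector_ne_zero hx), mul_zero,
      Finset.sum_eq_zero fun z _ => ?_]
    by_contra hz
    exact hx (isRoot_of_edge (left_ne_zero_of_mul hz)
      (isRoot_of_weightVector_ne_zero (right_ne_zero_of_mul hz)))

end WeightVector

section Harmonic

variable {V : Type*} [Fintype V] {w : V → V → ℝ} {T : Set (V × V)}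

/-- The Laplacian `f ↦ (x ↦ ∑ y, w x y * (f x - f y))` of the Markov chain that jumps from `x` to
`y` at rate `w x y`. -/
noncomputable def rateLaplacian (w : V → V → ℝ) : (V → ℝ) →ₗ[ℝ] V → ℝ where
  toFun f x := ∑ y, w x y * (f x - f y)
  map_add' f g := by
    ext x
    simp only [Pi.add_apply, ← Finset.sum_add_distrib]
    exact Finset.sum_congr rfl fun y _ => by ring
  map_smul' c f := by
    ext x
    simp only [Pi.smul_apply, smul_eq_mul, RingHom.id_apply, Finset.mul_sum]
    exact Finset.sum_congr rfl fun y _ => by ring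

theorem rateLaplacian_apply (w : V → V → ℝ) (f : V → ℝ) (x : V) :
    rateLaplacian w f x = ∑ y, w x y * (f x - f y) := rfl

theorem eq_of_rateLaplacian_nonpos_of_forall_le (hw : ∀ x y, 0 ≤ w x y) {f : V → ℝ} {x y : V}
    (hf : rateLaplacian w f x ≤ 0) (hmax : ∀ z, f z ≤ f x) (hxy : 0 < w x y) : f y = f x := by
  have hle : w x y * (f x - f y) ≤ rateLaplacian w f x :=
    Finset.single_le_sum (f := fun y => w x y * (f x - f y))
      (fun z _ => mul_nonneg (hw x z) (sub_nonneg.2 (hmax z))) (Finset.mem_univ y)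
  exact le_antisymm (hmax y)
    (sub_nonpos.1 (nonpos_of_mul_nonpos_right (hle.trans hf) hxy))

-- Follow a path backwards from a maximum: subharmonicity propagates the maximal value to a root.
theorem nonpos_of_rateLaplacian_nonpos (hw : ∀ x y, 0 ≤ w x y)
    (hT : ∀ x y, (x, y) ∈ T → 0 < w x y) {f : V → ℝ}
    (hf : ∀ x, 0 < f x → rateLaplacian w f x ≤ 0)
    (hroot : ∀ R : Reach T, ∃ u, R.IsRoot u ∧ f u ≤ 0) (x : V) : f x ≤ 0 := by
  by_contra! hx
  have : Nonempty V := ⟨x⟩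
  obtain ⟨x₀, hmax⟩ := Finite.exists_max f
  have hpos : 0 < f x₀ := hx.trans_le (hmax x)
  have eq_max {y : V} (h : Relation.ReflTransGen (EdgeFromTo T) y x₀) : f y = f x₀ := by
    induction h using Relation.ReflTransGen.head_induction_on with
    | refl => rfl
    | @head y z hyz _ ih =>
      rw [← ih] at hmax hpos ⊢
      exact eq_of_rateLaplacian_nonpos_of_forall_le hw (hf z hpos) hmax (hT z y hyz)
  obtain ⟨R, hR⟩ := exists_reach_mem T x₀
  obtain ⟨u, hu, hfu⟩ := hroot R
  exact hfu.not_gt (eq_max (hu.le hR) ▸ hpos)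

theorem eq_zero_of_rateLaplacian_eq_zero (hw : ∀ x y, 0 ≤ w x y)
    (hT : ∀ x y, (x, y) ∈ T → 0 < w x y) {f : V → ℝ}
    (hf : ∀ x, f x ≠ 0 → rateLaplacian w f x = 0)
    (hroot : ∀ R : Reach T, ∃ u, R.IsRoot u ∧ f u = 0) : f = 0 := by
  funext x
  refine le_antisymm (nonpos_of_rateLaplacian_nonpos hw hT (fun x hx => (hf x hx.ne').le)
    (fun R => (hroot R).imp fun u h => ⟨h.1, h.2.le⟩) x) (neg_nonpos.1 ?_)
  refine nonpos_of_rateLaplacian_nonpos (f := -f) hw hT (fun x hx => ?_)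
    (fun R => (hroot R).imp fun u h => ⟨h.1, (neg_eq_zero.2 h.2).le⟩) x
  rw [map_neg, Pi.neg_apply, hf x (neg_pos.1 hx).ne, neg_zero]

end Harmonic

theorem mulVec_extend_zero {n R : Type*} [Fintype n] [NonUnitalNonAssocSemiring R] {C : Set n}
    [Fintype C] (M : Matrix n n R) (g : C → R) (x : C) :
    M.mulVec (Function.extend Subtype.val g 0) x =
      (M.submatrix Subtype.val Subtype.val).mulVec g x := by
  refine (Fintype.sum_of_injective _ Subtype.val_injective _ _ (fun y hy => ?_) fun y => ?_).symm
  · rw [Function.extend_apply' _ _ _ hy, Pi.zero_apply, mul_zero]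
  · rw [Subtype.val_injective.extend_apply]
    rfl

namespace WeightedDigraph

variable {V : Type*} (G : WeightedDigraph V) (F : Set (V × V))

/-- The edge weights of the transpose of `(V, F)`. -/
noncomputable def transposedWeight (x y : V) : ℝ := G.restrictWeight F y x

theorem restrictWeight_nonneg (x y : V) : 0 ≤ G.restrictWeight F x y := by
  unfold restrictWeight
  split_ifs
  exacts [G.a_nonneg x y, le_rfl]

theorem restrictWeight_le (x y : V) : G.restrictWeight F x y ≤ G.a x y := by
  unfold restrictWeight
  split_ifs
  exacts [le_rfl, G.a_nonneg x y]

theorem transposedWeight_nonneg (x y : V) : 0 ≤ G.transposedWeight F x y :=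
  G.restrictWeight_nonneg F y x

variable {F}

theorem restrictWeight_diff_add (x y : V) :
    G.restrictWeight (G.edges \ F) x y + G.restrictWeight F x y = G.a x y := by
  by_cases hxy : (x, y) ∈ F
  · simp [restrictWeight, hxy]
  · by_cases hE : (x, y) ∈ G.edges
    · simp [restrictWeight, hxy, hE]
    · have ha : G.a x y = 0 := le_antisymm (not_lt.1 hE) (G.a_nonneg x y)
      simp [restrictWeight, ha]

theorem transposedWeight_eq {x y : V} (h : (x, y) ∈ transposeEdges F) :
    G.transposedWeight F x y = G.a y x :=
  if_pos h

theorem transposedWeight_eq_zero {x y : V} (h : (x, y) ∉ transposeEdges F) :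
    G.transposedWeight F x y = 0 :=
  if_neg h

theorem transposedWeight_pos (hF : F ⊆ G.edges) {x y : V} (h : (x, y) ∈ transposeEdges F) :
    0 < G.transposedWeight F x y := by
  rw [G.transposedWeight_eq h]
  exact hF h

section GammaLeft

variable [Fintype V]

theorem inLaplacianTranspose_mulVec (f : V → ℝ) (x : V) :
    (G.inLaplacianTranspose F).mulVec f x =
      1 / G.m x * rateLaplacian (G.transposedWeight F) f x := by
  classical
  simp only [Matrix.mulVec, dotProduct, inLaplacianTranspose, Matrix.of_apply, mul_sub, sub_mul,
    Finset.sum_sub_distrib, mul_ite, ite_mul, mul_zero, zero_mul, Finset.sum_ite_eq,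
    Finset.mem_univ, if_true, rateLaplacian_apply, transposedWeight, Finset.mul_sum,
    Finset.sum_mul, mul_assoc]

theorem inLaplacianTranspose_mulVec_eq_zero_iff {f : V → ℝ} {x : V} :
    (G.inLaplacianTranspose F).mulVec f x = 0 ↔ rateLaplacian (G.transposedWeight F) f x = 0 := by
  rw [inLaplacianTranspose_mulVec, mul_eq_zero, or_iff_right (one_div_ne_zero (G.m_pos x).ne')]

open Classical in
theorem isUnit_commonBlock (hF : F ⊆ G.edges) (R : Reach (transposeEdges F)) :
    IsUnit (G.commonBlock F R) := by
  rw [← Matrix.mulVec_injective_iff_isUnit]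
  refine (injective_iff_map_eq_zero (G.commonBlock F R).mulVecLin).2 fun g hg => ?_
  set f : V → ℝ := Function.extend Subtype.val g 0 with hf
  have hf_off (v : V) (hv : v ∉ commonPart (transposeEdges F) R) : f v = 0 :=
    Function.extend_apply' _ _ _ fun ⟨y, hy⟩ => hv (hy ▸ y.2)
  have hf_zero : f = 0 := by
    refine eq_zero_of_rateLaplacian_eq_zero (G.transposedWeight_nonneg F)
      (fun _ _ => G.transposedWeight_pos hF) (fun x hx => ?_)
      fun S => ⟨S.root, S.isRoot_root, hf_off _ (S.root_notMem_commonPart R)⟩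
    have hxC : x ∈ commonPart (transposeEdges F) R := not_not.1 fun h => hx (hf_off x h)
    rw [← inLaplacianTranspose_mulVec_eq_zero_iff]
    exact (mulVec_extend_zero _ g ⟨x, hxC⟩).trans (congrFun hg _)
  funext y
  rw [← Subtype.val_injective.extend_apply g 0 y, ← hf, hf_zero, Pi.zero_apply, Pi.zero_apply]

theorem gammaLeft_of_mem_exclusivePart {R : Reach (transposeEdges F)} {v : V}
    (h : v ∈ exclusivePart (transposeEdges F) R) : G.gammaLeft F R v = 1 := if_pos h

theorem gammaLeft_of_notMem {R : Reach (transposeEdges F)} {v : V} (h : v ∉ R.1) :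
    G.gammaLeft F R v = 0 := by
  rw [gammaLeft, if_neg fun h' => h h'.1, dif_neg fun h' => h h'.1]

open Classical in
theorem gammaLeft_eq_indicator_add_extend (R : Reach (transposeEdges F)) :
    G.gammaLeft F R = Set.indicator (exclusivePart (transposeEdges F) R) 1 +
      Function.extend Subtype.val (-(G.commonBlock F R)⁻¹.mulVec fun x =>
        (G.inLaplacianTranspose F).mulVec
          (Set.indicator (exclusivePart (transposeEdges F) R) 1) x.1) 0 := by
  funext v
  rw [Pi.add_apply, gammaLeft]
  split_ifs with hH hC
  · rw [Set.indicator_of_mem hH, Function.extend_apply' _ _ _ fun ⟨y, hy⟩ =>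
      notMem_commonPart_of_mem_exclusivePart hH (hy ▸ y.2)]
    exact (add_zero 1).symm
  · rw [Set.indicator_of_notMem hH, zero_add,
      Subtype.val_injective.extend_apply _ _ (⟨v, hC⟩ : commonPart (transposeEdges F) R)]
    simp only [Matrix.mulVec, dotProduct, Set.indicator_apply, Pi.one_apply, mul_ite, mul_one,
      mul_zero, Finset.sum_filter, Pi.neg_apply]
  · rw [Set.indicator_of_notMem hH, Function.extend_apply' _ _ _ fun ⟨y, hy⟩ => hC (hy ▸ y.2)]
    exact (add_zero 0).symm

theorem rateLaplacian_gammaLeft_of_mem_commonPart (hF : F ⊆ G.edges)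
    {R : Reach (transposeEdges F)} {x : V} (hx : x ∈ commonPart (transposeEdges F) R) :
    rateLaplacian (G.transposedWeight F) (G.gammaLeft F R) x = 0 := by
  classical
  have hdet : IsUnit (G.commonBlock F R).det :=
    (Matrix.isUnit_iff_isUnit_det _).1 (G.isUnit_commonBlock hF R)
  rw [← inLaplacianTranspose_mulVec_eq_zero_iff, gammaLeft_eq_indicator_add_extend,
    Matrix.mulVec_add, Pi.add_apply, mulVec_extend_zero _ _ ⟨x, hx⟩, ← commonBlock,
    Matrix.mulVec_neg, Matrix.mulVec_mulVec, Matrix.mul_nonsing_inv _ hdet, Matrix.one_mulVec,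
    Pi.neg_apply, add_neg_cancel]

theorem rateLaplacian_gammaLeft (hF : F ⊆ G.edges) (R : Reach (transposeEdges F)) :
    rateLaplacian (G.transposedWeight F) (G.gammaLeft F R) = 0 := by
  funext x
  have eq_zero_of_edge (h : ∀ y, EdgeFromTo (transposeEdges F) y x →
      G.gammaLeft F R y = G.gammaLeft F R x) :
      rateLaplacian (G.transposedWeight F) (G.gammaLeft F R) x = 0 := by
    refine Finset.sum_eq_zero fun y _ => ?_
    by_cases hy : (x, y) ∈ transposeEdges F
    · rw [h y hy, sub_self, mul_zero]
    · rw [G.transposedWeight_eq_zero hy, zero_mul]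
  by_cases hx : x ∈ R.1
  · rcases mem_exclusivePart_or_mem_commonPart hx with hH | hC
    · refine eq_zero_of_edge fun y hy => ?_
      rw [G.gammaLeft_of_mem_exclusivePart hH,
        G.gammaLeft_of_mem_exclusivePart (mem_exclusivePart_of_edge hy hH)]
    · exact G.rateLaplacian_gammaLeft_of_mem_commonPart hF hC
  · refine eq_zero_of_edge fun y hy => ?_
    rw [G.gammaLeft_of_notMem hx, G.gammaLeft_of_notMem fun h =>
      hx (Reach.mem_of_reachable h (Relation.ReflTransGen.single hy))]

theorem gammaLeft_of_isRoot [DecidableEq (Reach (transposeEdges F))]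
    {S : Reach (transposeEdges F)} {u : V} (hu : S.IsRoot u) (R : Reach (transposeEdges F)) :
    G.gammaLeft F R u = if R = S then 1 else 0 := by
  split_ifs with h
  · exact G.gammaLeft_of_mem_exclusivePart (h ▸ hu.mem_exclusivePart)
  · exact G.gammaLeft_of_notMem fun hmem => h (hu.eq_of_mem hmem)

theorem gammaLeft_nonneg (hF : F ⊆ G.edges) (R : Reach (transposeEdges F)) (x : V) :
    0 ≤ G.gammaLeft F R x := by
  classical
  refine neg_nonpos.1 (nonpos_of_rateLaplacian_nonpos (f := -G.gammaLeft F R)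
    (G.transposedWeight_nonneg F) (fun _ _ => G.transposedWeight_pos hF) (fun x _ => ?_)
    (fun S => ⟨S.root, S.isRoot_root, ?_⟩) x)
  · rw [map_neg, G.rateLaplacian_gammaLeft hF, neg_zero, Pi.zero_apply]
  · rw [Pi.neg_apply, neg_nonpos, G.gammaLeft_of_isRoot S.isRoot_root]
    split_ifs
    exacts [zero_le_one, le_rfl]

theorem eq_sum_gammaLeft_of_rateLaplacian_eq_zero (hF : F ⊆ G.edges) {f : V → ℝ}
    (hf : rateLaplacian (G.transposedWeight F) f = 0) :
    f = ∑ R : Reach (transposeEdges F), f R.root • G.gammaLeft F R := by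
  classical
  rw [← sub_eq_zero]
  refine eq_zero_of_rateLaplacian_eq_zero (G.transposedWeight_nonneg F)
    (fun _ _ => G.transposedWeight_pos hF) (fun x _ => ?_)
    fun S => ⟨S.root, S.isRoot_root, ?_⟩
  · simp only [map_sub, map_sum, map_smul, hf, G.rateLaplacian_gammaLeft hF, smul_zero,
      Finset.sum_const_zero, sub_zero, Pi.zero_apply]
  · simp only [Pi.sub_apply, Finset.sum_apply, Pi.smul_apply, G.gammaLeft_of_isRoot S.isRoot_root,
      smul_eq_mul, mul_ite, mul_one, mul_zero, Finset.sum_ite_eq', Finset.mem_univ, if_true,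
      sub_self]

theorem sum_gammaLeft (hF : F ⊆ G.edges) (x : V) :
    ∑ R : Reach (transposeEdges F), G.gammaLeft F R x = 1 := by
  have hone : rateLaplacian (G.transposedWeight F) 1 = 0 := by
    funext x
    simp only [rateLaplacian_apply, Pi.one_apply, sub_self, mul_zero, Finset.sum_const_zero,
      Pi.zero_apply]
  have h := congrFun (G.eq_sum_gammaLeft_of_rateLaplacian_eq_zero hF hone) x
  simpa only [Pi.one_apply, one_smul, Finset.sum_apply] using h.symm

end GammaLeft

section GammaRight

variable [Fintype V]

theorem gammaRight_eq (R : Reach (transposeEdges F)) (j : V) :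
    G.gammaRight F R j = weightVector (G.transposedWeight F) (transposeEdges F) R j /
      ∑ k, G.m k * weightVector (G.transposedWeight F) (transposeEdges F) R k := by
  have h (k : V) : weightVector (fun x y => G.a y x) (transposeEdges F) R k =
      weightVector (G.transposedWeight F) (transposeEdges F) R k :=
    weightVector_congr (fun _ _ hxy => (G.transposedWeight_eq hxy).symm) k
  simp only [gammaRight, h]

theorem sum_mass_mul_weightVector_pos (hF : F ⊆ G.edges) (R : Reach (transposeEdges F)) :
    0 < ∑ k, G.m k * weightVector (G.transposedWeight F) (transposeEdges F) R k :=
  Finset.sum_pos' (fun k _ => mul_nonneg (G.m_pos k).le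
      (weightVector_nonneg (G.transposedWeight_nonneg F) k))
    ⟨R.root, Finset.mem_univ _, mul_pos (G.m_pos _) (R.isRoot_root.weightVector_pos
      (G.transposedWeight_nonneg F) fun _ _ => G.transposedWeight_pos hF)⟩

theorem gammaRight_nonneg (R : Reach (transposeEdges F)) (x : V) : 0 ≤ G.gammaRight F R x := by
  have hnonneg := weightVector_nonneg (R := R) (G.transposedWeight_nonneg F)
  rw [gammaRight_eq]
  exact div_nonneg (hnonneg x)
    (Finset.sum_nonneg fun k _ => mul_nonneg (G.m_pos k).le (hnonneg k))

theorem isRoot_of_gammaRight_ne_zero {R : Reach (transposeEdges F)} {x : V}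
    (h : G.gammaRight F R x ≠ 0) : R.IsRoot x :=
  isRoot_of_weightVector_ne_zero (div_ne_zero_iff.1 h).1

theorem sum_mass_mul_gammaRight (hF : F ⊆ G.edges) (R : Reach (transposeEdges F)) :
    ∑ x, G.m x * G.gammaRight F R x = 1 := by
  simp only [gammaRight_eq, mul_div_assoc', ← Finset.sum_div]
  exact div_self (G.sum_mass_mul_weightVector_pos hF R).ne'

theorem sum_restrictWeight_mul_gammaRight (R : Reach (transposeEdges F)) (x : V) :
    (∑ j, G.restrictWeight F j x) * G.gammaRight F R x =
      ∑ y, G.restrictWeight F x y * G.gammaRight F R y := by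
  simp only [gammaRight_eq, mul_div_assoc', ← Finset.sum_div]
  exact congrArg (· / _) (sum_mul_weightVector (fun _ _ => G.transposedWeight_eq_zero) x)

theorem gammaLeft_mul_gammaRight [DecidableEq (Reach (transposeEdges F))]
    (R S : Reach (transposeEdges F)) (x : V) :
    G.gammaLeft F R x * G.gammaRight F S x = if R = S then G.gammaRight F S x else 0 := by
  by_cases h : G.gammaRight F S x = 0
  · rw [h, mul_zero, ite_self]
  · rw [G.gammaLeft_of_isRoot (G.isRoot_of_gammaRight_ne_zero h), ite_mul, one_mul, zero_mul]

end GammaRight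

end WeightedDigraph

section EquivalentNorm

variable {𝕜 E E' : Type*} [NontriviallyNormedField 𝕜] [SeminormedAddCommGroup E]
  [SeminormedAddCommGroup E'] [NormedSpace 𝕜 E] [NormedSpace 𝕜 E']

theorem opNorm_le_of_norm_equiv_apply_le (e : E ≃L[𝕜] E') {T : E →L[𝕜] E}
    (hT : ∀ f, ‖e (T f)‖ ≤ ‖e f‖) :
    ‖T‖ ≤ ‖(e.symm : E' →L[𝕜] E)‖ * ‖(e : E →L[𝕜] E')‖ := by
  refine T.opNorm_le_bound (by positivity) fun f => ?_
  calc ‖T f‖ = ‖(e.symm : E' →L[𝕜] E) (e (T f))‖ := by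
        rw [ContinuousLinearEquiv.coe_coe, e.symm_apply_apply]
    _ ≤ ‖(e.symm : E' →L[𝕜] E)‖ * ‖e (T f)‖ := ContinuousLinearMap.le_opNorm _ _
    _ ≤ ‖(e.symm : E' →L[𝕜] E)‖ * (‖(e : E →L[𝕜] E')‖ * ‖f‖) := by
        gcongr
        exact (hT f).trans ((e : E →L[𝕜] E').le_opNorm f)
    _ = _ := (mul_assoc _ _ _).symm

theorem opNorm_pow_le_of_norm_equiv_apply_le (e : E ≃L[𝕜] E') {T : E →L[𝕜] E}
    (hT : ∀ f, ‖e (T f)‖ ≤ ‖e f‖) (n : ℕ) :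
    ‖T ^ n‖ ≤ ‖(e.symm : E' →L[𝕜] E)‖ * ‖(e : E →L[𝕜] E')‖ := by
  refine opNorm_le_of_norm_equiv_apply_le e ?_
  induction n with
  | zero => exact fun f => le_rfl
  | succ n ih => exact fun f => pow_succ' T n ▸ (hT _).trans (ih f)

end EquivalentNorm

namespace WeightedDigraph

section MassNorm

variable {V : Type*} (G : WeightedDigraph V)

theorem ofReal_mass_ne_zero (x : V) : (G.m x : ℂ) ≠ 0 := Complex.ofReal_ne_zero.2 (G.m_pos x).ne'

variable [Fintype V]

theorem outLaplacianWith_apply (w : V → V → ℝ) (f : G.Ell2) (x : V) :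
    G.outLaplacianWith w f x =
      (1 / (G.m x : ℂ)) * ((∑ j, (w j x : ℂ)) * f x - ∑ y, (w x y : ℂ) * f y) := rfl

theorem outLaplacianWith_add_smul (w₀ w₁ : V → V → ℝ) (β : ℝ) :
    G.outLaplacianWith w₀ + β • G.outLaplacianWith w₁ =
      G.outLaplacianWith fun x y => w₀ x y + β * w₁ x y := by
  refine ContinuousLinearMap.ext fun f => funext fun x => ?_
  change G.outLaplacianWith w₀ f x + β * G.outLaplacianWith w₁ f x = _
  simp only [outLaplacianWith_apply, Complex.ofReal_add, Complex.ofReal_mul, add_mul,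
    Finset.sum_add_distrib, mul_assoc, ← Finset.mul_sum]
  ring

/-- Multiplication by the node masses, which transports the norm of `ℓ¹` to the mass-weighted
`ℓ¹` norm on `ℓ²(G)`. -/
noncomputable def massEquiv : G.Ell2 ≃L[ℂ] PiLp 1 fun _ : V => ℂ :=
  LinearEquiv.toContinuousLinearEquiv
    { toFun := fun f => WithLp.toLp 1 fun x => (G.m x : ℂ) * f x
      map_add' := fun f g => PiLp.ext fun x => mul_add (G.m x : ℂ) (f x) (g x)
      map_smul' := fun c f => PiLp.ext fun x => mul_left_comm (G.m x : ℂ) c (f x)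
      invFun := fun g x => g x / G.m x
      left_inv := fun f => funext fun x => mul_div_cancel_left₀ (f x) (G.ofReal_mass_ne_zero x)
      right_inv := fun g => PiLp.ext fun x => mul_div_cancel₀ (g x) (G.ofReal_mass_ne_zero x) }

theorem norm_massEquiv (f : G.Ell2) : ‖G.massEquiv f‖ = ∑ x, ‖(G.m x : ℂ) * f x‖ :=
  PiLp.norm_eq_of_L1 (G.massEquiv f)

/-- The one-step operator `1 - κ⁻¹ L⁺_w` of the discrete-time chain obtained by uniformizing the
semigroup of `L⁺_w` at rate `κ`. -/
noncomputable def uniformization (w : V → V → ℝ) (κ : ℝ) : G.Ell2 →L[ℂ] G.Ell2 :=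
  1 - κ⁻¹ • G.outLaplacianWith w

theorem smul_one_sub_uniformization (w : V → V → ℝ) {κ : ℝ} (hκ : κ ≠ 0) :
    κ • (1 - G.uniformization w κ) = G.outLaplacianWith w := by
  rw [uniformization, sub_sub_cancel, smul_inv_smul₀ hκ]

theorem mass_mul_uniformization_apply (w : V → V → ℝ) (κ : ℝ) (f : G.Ell2) (x : V) :
    G.m x * G.uniformization w κ f x =
      (G.m x - κ⁻¹ * ∑ j, w j x : ℝ) * f x + (κ⁻¹ : ℝ) * ∑ y, (w x y : ℂ) * f y := by
  change G.m x * (f x - (κ⁻¹ : ℝ) * G.outLaplacianWith w f x) = _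
  have hm := G.ofReal_mass_ne_zero x
  rw [outLaplacianWith_apply]
  push_cast
  field_simp
  ring

theorem norm_mass_mul_uniformization_apply_le {w : V → V → ℝ} (hw : ∀ x y, 0 ≤ w x y) {κ : ℝ}
    (hκ : 0 < κ) {x : V} (hwκ : ∑ j, w j x ≤ κ * G.m x) (f : G.Ell2) :
    ‖(G.m x : ℂ) * G.uniformization w κ f x‖ ≤
      (G.m x - κ⁻¹ * ∑ j, w j x) * ‖f x‖ + κ⁻¹ * ∑ y, w x y * ‖f y‖ := by
  rw [mass_mul_uniformization_apply]
  refine (norm_add_le _ _).trans (add_le_add ?_ ?_)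
  · rw [norm_mul, Complex.norm_real, Real.norm_of_nonneg]
    rwa [sub_nonneg, inv_mul_le_iff₀ hκ]
  · rw [norm_mul, Complex.norm_real, Real.norm_of_nonneg (inv_nonneg.2 hκ.le)]
    gcongr
    refine norm_sum_le_of_le _ fun y _ => ?_
    rw [norm_mul, Complex.norm_real, Real.norm_of_nonneg (hw x y)]

theorem norm_massEquiv_uniformization_le {w : V → V → ℝ} (hw : ∀ x y, 0 ≤ w x y) {κ : ℝ}
    (hκ : 0 < κ) (hwκ : ∀ x, ∑ j, w j x ≤ κ * G.m x) (f : G.Ell2) :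
    ‖G.massEquiv (G.uniformization w κ f)‖ ≤ ‖G.massEquiv f‖ := by
  have hcomm : ∑ x, ∑ y, w x y * ‖f y‖ = ∑ x, (∑ j, w j x) * ‖f x‖ := by
    rw [Finset.sum_comm]
    simp only [Finset.sum_mul]
  simp only [norm_massEquiv]
  calc ∑ x, ‖(G.m x : ℂ) * G.uniformization w κ f x‖
      ≤ ∑ x, ((G.m x - κ⁻¹ * ∑ j, w j x) * ‖f x‖ + κ⁻¹ * ∑ y, w x y * ‖f y‖) :=
        Finset.sum_le_sum fun x _ => G.norm_mass_mul_uniformization_apply_le hw hκ (hwκ x) f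
    _ = ∑ x, G.m x * ‖f x‖ := by
        rw [Finset.sum_add_distrib, ← Finset.mul_sum, hcomm, Finset.mul_sum,
          ← Finset.sum_add_distrib]
        exact Finset.sum_congr rfl fun x _ => by ring
    _ = ∑ x, ‖(G.m x : ℂ) * f x‖ := Finset.sum_congr rfl fun x _ => by
        rw [norm_mul, Complex.norm_real, Real.norm_of_nonneg (G.m_pos x).le]

end MassNorm

section CoupledBounds

variable {V : Type*} [Fintype V] (G : WeightedDigraph V) (F : Set (V × V))

theorem outLaplacianCoupled_eq_add_smul (β : ℝ) :
    G.outLaplacianCoupled F β = G.outLaplacianOn (G.edges \ F) + β • G.outLaplacianOn F :=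
  rfl

theorem exists_outDegree_le_mul_mass : ∃ c : ℝ, 0 < c ∧ ∀ x, ∑ j, G.a j x ≤ c * G.m x := by
  obtain ⟨c, hc⟩ := (Set.finite_range fun x => (∑ j, G.a j x) / G.m x).bddAbove
  refine ⟨max c 1, by positivity, fun x => ?_⟩
  rw [← div_le_iff₀ (G.m_pos x)]
  exact (hc (Set.mem_range_self x)).trans (le_max_left c 1)

theorem sum_restrictWeight_add_mul_le {c β : ℝ} (hc : ∀ x, ∑ j, G.a j x ≤ c * G.m x) (hβ : 0 ≤ β)
    (E : Set (V × V)) (x : V) :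
    ∑ j, (G.restrictWeight E j x + β * G.restrictWeight F j x) ≤ (1 + β) * c * G.m x :=
  calc ∑ j, (G.restrictWeight E j x + β * G.restrictWeight F j x)
      ≤ ∑ j, (G.a j x + β * G.a j x) := by
        gcongr <;> exact G.restrictWeight_le _ _ _
    _ = (1 + β) * ∑ j, G.a j x := by rw [Finset.sum_add_distrib, ← Finset.mul_sum]; ring
    _ ≤ (1 + β) * c * G.m x := by rw [mul_assoc]; gcongr; exact hc x

-- The uniformized chain contracts the mass-weighted `ℓ¹` norm, for every `β` the same norm.
theorem exists_outLaplacianCoupled_eq_smul_one_sub : ∃ C c : ℝ, 0 < c ∧ ∀ β : ℝ, 0 ≤ β →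
    ∃ K : G.Ell2 →L[ℂ] G.Ell2, (∀ n, ‖K ^ n‖ ≤ C) ∧
      G.outLaplacianCoupled F β = ((1 + β) * c) • (1 - K) := by
  obtain ⟨c, hc, hdeg⟩ := G.exists_outDegree_le_mul_mass
  refine ⟨_, c, hc, fun β hβ => ⟨G.uniformization (fun x y => G.restrictWeight (G.edges \ F) x y +
    β * G.restrictWeight F x y) ((1 + β) * c), opNorm_pow_le_of_norm_equiv_apply_le G.massEquiv <|
    G.norm_massEquiv_uniformization_le (fun x y => ?_) (by positivity)
      (G.sum_restrictWeight_add_mul_le F hdeg hβ _), ?_⟩⟩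
  · exact add_nonneg (G.restrictWeight_nonneg _ x y)
      (mul_nonneg hβ (G.restrictWeight_nonneg F x y))
  · rw [smul_one_sub_uniformization _ _ (by positivity), outLaplacianCoupled_eq_add_smul]
    exact G.outLaplacianWith_add_smul _ _ β

theorem tendsto_exp_outLaplacianCoupled {P Z : G.Ell2 →L[ℂ] G.Ell2}
    (hP : G.outLaplacianOn F * P = 0) (hZ : 1 - P = G.outLaplacianOn F * Z) {t : ℝ} (ht : 0 < t) :
    Tendsto (fun β => NormedSpace.exp (-t • G.outLaplacianCoupled F β)) atTop
      (𝓝 (NormedSpace.exp (-t • (P * G.outLaplacianOn (G.edges \ F))) * P)) := by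
  have : CompleteSpace G.Ell2 := FiniteDimensional.complete ℂ _
  obtain ⟨C, c, hc, hK⟩ := G.exists_outLaplacianCoupled_eq_smul_one_sub F
  simp only [outLaplacianCoupled_eq_add_smul] at hK ⊢
  refine tendsto_exp_neg_smul_add_smul hP hZ (C := C) ht.le (fun β hβ s hs => ?_)
    (tendsto_inv_mul_of_le_mul_sqrt (C := C) (c := c / t) (fun _ => norm_nonneg _) fun β hβ => ?_)
  · obtain ⟨K, hC, hKβ⟩ := hK β hβ
    rw [hKβ]
    exact norm_exp_neg_smul_smul_one_sub_le hC (by positivity) hs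
  · obtain ⟨K, hC, hKβ⟩ := hK β hβ
    rw [hKβ, ← mul_div_assoc]
    exact norm_smul_one_sub_mul_exp_le hC (by positivity) ht

end CoupledBounds

end WeightedDigraph

section BiorthogonalProjection

variable {𝕜 E ι : Type*} [RCLike 𝕜] [NormedAddCommGroup E] [InnerProductSpace 𝕜 E] [Fintype ι]

/-- The operator `∑ i, ⟨l i, ·⟩ r i`, which for biorthogonal families `l` and `r` is the projection
onto the span of `r` along the orthogonal complement of `l`. -/
noncomputable def biorthogonalProjection (l r : ι → E) : E →L[𝕜] E :=
  ∑ i, InnerProductSpace.rankOne 𝕜 (r i) (l i)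

variable {l r : ι → E} {A : E →L[𝕜] E}

theorem biorthogonalProjection_apply (f : E) :
    biorthogonalProjection (𝕜 := 𝕜) l r f = ∑ i, inner 𝕜 (l i) f • r i := by
  simp only [biorthogonalProjection, sum_apply, InnerProductSpace.rankOne_apply]

theorem mul_biorthogonalProjection_eq_zero (hr : ∀ i, A (r i) = 0) :
    A * biorthogonalProjection l r = 0 := by
  ext f
  simp only [mul_apply_eq_comp, biorthogonalProjection_apply, map_sum, map_smul, hr,
    smul_zero, Finset.sum_const_zero, zero_apply]

theorem biorthogonalProjection_mul_eq_zero (hl : ∀ i f, inner 𝕜 (l i) (A f) = 0) :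
    biorthogonalProjection l r * A = 0 := by
  ext f
  simp only [mul_apply_eq_comp, biorthogonalProjection_apply, hl, zero_smul,
    Finset.sum_const_zero, zero_apply]

variable [DecidableEq ι]

theorem inner_biorthogonalProjection (hlr : ∀ i j, inner 𝕜 (l i) (r j) = if i = j then 1 else 0)
    (i : ι) (f : E) : inner 𝕜 (l i) (biorthogonalProjection (𝕜 := 𝕜) l r f) = inner 𝕜 (l i) f := by
  simp only [biorthogonalProjection_apply, inner_sum, inner_smul_right, hlr, mul_ite, mul_one,
    mul_zero, Finset.sum_ite_eq, Finset.mem_univ, if_true]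

theorem isIdempotentElem_biorthogonalProjection
    (hlr : ∀ i j, inner 𝕜 (l i) (r j) = if i = j then 1 else 0) :
    IsIdempotentElem (biorthogonalProjection (𝕜 := 𝕜) l r) := by
  ext f
  rw [mul_apply_eq_comp, biorthogonalProjection_apply]
  simp only [inner_biorthogonalProjection hlr]
  rw [biorthogonalProjection_apply]

theorem exists_one_sub_biorthogonalProjection_eq_mul [FiniteDimensional 𝕜 E]
    (hlr : ∀ i j, inner 𝕜 (l i) (r j) = if i = j then 1 else 0)
    (hA : ∀ g, (∀ f, inner 𝕜 g (A f) = 0) → g ∈ Submodule.span 𝕜 (Set.range l)) :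
    ∃ Z : E →L[𝕜] E, 1 - biorthogonalProjection l r = A * Z := by
  set P : E →L[𝕜] E := biorthogonalProjection l r
  have hspan : A.toLinearMap.rangeᗮ ≤ Submodule.span 𝕜 (Set.range l) := fun g hg =>
    hA g fun f => (Submodule.mem_orthogonal' _ _).1 hg _ ⟨f, rfl⟩
  have hmem (f : E) : (1 - P : E →L[𝕜] E).toLinearMap f ∈ A.toLinearMap.range := by
    rw [← Submodule.orthogonal_orthogonal A.toLinearMap.range]
    refine Submodule.orthogonal_le hspan ((Submodule.mem_orthogonal _ _).2 fun g hg => ?_)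
    induction hg using Submodule.span_induction with
    | mem _ h =>
      obtain ⟨i, rfl⟩ := h
      change inner 𝕜 (l i) (f - P f) = 0
      rw [inner_sub_right, inner_biorthogonalProjection hlr, sub_self]
    | zero => exact inner_zero_left _
    | add g₁ g₂ _ _ h₁ h₂ => rw [inner_add_left, h₁, h₂, add_zero]
    | smul c g _ h => rw [inner_smul_left, h, mul_zero]
  obtain ⟨Z, hZ⟩ := Module.projective_lifting_property A.toLinearMap.rangeRestrict
    ((1 - P : E →L[𝕜] E).toLinearMap.codRestrict _ hmem) A.toLinearMap.surjective_rangeRestrict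
  exact ⟨LinearMap.toContinuousLinearMap Z, ContinuousLinearMap.ext fun f =>
    (congrArg Subtype.val (LinearMap.congr_fun hZ f)).symm⟩

end BiorthogonalProjection

namespace WeightedDigraph

section KernelProjection

variable {V : Type*} [Fintype V] (G : WeightedDigraph V)

theorem inner_eq_sum (f g : G.Ell2) :
    inner ℂ f g = ∑ x, (starRingEnd ℂ) (f x) * g x * (G.m x : ℂ) := rfl

theorem inner_outLaplacianWith (w : V → V → ℝ) (g f : G.Ell2) :
    inner ℂ g (G.outLaplacianWith w f) =
      ∑ y, (starRingEnd ℂ) (∑ x, (w x y : ℂ) * (g y - g x)) * f y := by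
  have hterm (x : V) : (starRingEnd ℂ) (g x) * G.outLaplacianWith w f x * (G.m x : ℂ) =
      (∑ j, (w j x : ℂ) * (starRingEnd ℂ) (g x) * f x) -
        ∑ y, (w x y : ℂ) * (starRingEnd ℂ) (g x) * f y := by
    have hm := G.ofReal_mass_ne_zero x
    simp only [outLaplacianWith_apply, mul_right_comm _ ((starRingEnd ℂ) (g x)), ← Finset.sum_mul]
    field_simp
  rw [inner_eq_sum, Finset.sum_congr rfl fun x _ => hterm x, Finset.sum_sub_distrib,
    Finset.sum_comm (f := fun x y => (w x y : ℂ) * (starRingEnd ℂ) (g x) * f y)]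
  simp only [map_sum, map_mul, map_sub, Complex.conj_ofReal, mul_sub, Finset.sum_sub_distrib,
    sub_mul, Finset.sum_mul]

theorem inner_outLaplacianWith_eq_zero_iff {w : V → V → ℝ} {g : G.Ell2} :
    (∀ f, inner ℂ g (G.outLaplacianWith w f) = 0) ↔
      ∀ y, ∑ x, (w x y : ℂ) * (g y - g x) = 0 := by
  classical
  simp only [inner_outLaplacianWith]
  refine ⟨fun h y => ?_, fun h f => Finset.sum_eq_zero fun y _ => by
    rw [h y, map_zero, zero_mul]⟩
  have hy := h (Pi.single (M := fun _ : V => ℂ) y 1)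
  rwa [Finset.sum_eq_single y (fun b _ hb => by
      rw [Pi.single_eq_of_ne (M := fun _ : V => ℂ) hb, mul_zero])
    fun h => absurd (Finset.mem_univ y) h, Pi.single_eq_same (M := fun _ : V => ℂ), mul_one,
    map_eq_zero] at hy

variable (F : Set (V × V))

/-- The left kernel vector `gammaLeft` of `L⁺_F`, as an element of `ℓ²(G)`. -/
noncomputable def leftVector (R : Reach (transposeEdges F)) : G.Ell2 :=
  fun v => (G.gammaLeft F R v : ℂ)

/-- The right kernel vector `gammaRight` of `L⁺_F`, as an element of `ℓ²(G)`. -/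
noncomputable def rightVector (R : Reach (transposeEdges F)) : G.Ell2 :=
  fun v => (G.gammaRight F R v : ℂ)

/-- The projection onto the kernel of `L⁺_F` along its range. -/
noncomputable def kernelProjection : G.Ell2 →L[ℂ] G.Ell2 :=
  biorthogonalProjection (G.leftVector F) (G.rightVector F)

variable {F}

theorem leftVector_apply (R : Reach (transposeEdges F)) (x : V) :
    G.leftVector F R x = G.gammaLeft F R x := rfl

theorem rightVector_apply (R : Reach (transposeEdges F)) (x : V) :
    G.rightVector F R x = G.gammaRight F R x := rfl

theorem inner_leftVector_rightVector [DecidableEq (Reach (transposeEdges F))] (hF : F ⊆ G.edges)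
    (R S : Reach (transposeEdges F)) :
    inner ℂ (G.leftVector F R) (G.rightVector F S) = if R = S then 1 else 0 := by
  have hterm (x : V) : (starRingEnd ℂ) (G.leftVector F R x) * G.rightVector F S x * (G.m x : ℂ) =
      if R = S then ((G.m x * G.gammaRight F S x : ℝ) : ℂ) else 0 := by
    rw [leftVector_apply, rightVector_apply, Complex.conj_ofReal, ← Complex.ofReal_mul,
      gammaLeft_mul_gammaRight]
    split_ifs
    · rw [← Complex.ofReal_mul, mul_comm]
    · rw [Complex.ofReal_zero, zero_mul]
  simp only [inner_eq_sum, hterm]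
  split_ifs
  · rw [← Complex.ofReal_sum, G.sum_mass_mul_gammaRight hF, Complex.ofReal_one]
  · exact Finset.sum_const_zero

theorem outLaplacianOn_rightVector (R : Reach (transposeEdges F)) :
    G.outLaplacianOn F (G.rightVector F R) = 0 := by
  refine funext fun x => ?_
  have h : ((∑ j, G.restrictWeight F j x : ℝ) : ℂ) * G.gammaRight F R x =
      ∑ y, (G.restrictWeight F x y : ℂ) * G.gammaRight F R y :=
    mod_cast G.sum_restrictWeight_mul_gammaRight R x
  rw [Complex.ofReal_sum] at h
  change G.outLaplacianWith (G.restrictWeight F) (G.rightVector F R) x = 0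
  simp only [outLaplacianWith_apply, rightVector_apply, h, sub_self, mul_zero]

theorem inner_leftVector_outLaplacianOn (hF : F ⊆ G.edges) (R : Reach (transposeEdges F))
    (f : G.Ell2) : inner ℂ (G.leftVector F R) (G.outLaplacianOn F f) = 0 := by
  refine G.inner_outLaplacianWith_eq_zero_iff.2 (fun y => ?_) f
  simp only [leftVector_apply]
  exact mod_cast congrFun (G.rateLaplacian_gammaLeft hF R) y

theorem eq_sum_smul_leftVector (hF : F ⊆ G.edges) {g : G.Ell2}
    (hg : ∀ f, inner ℂ g (G.outLaplacianOn F f) = 0) :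
    g = ∑ R : Reach (transposeEdges F), g R.root • G.leftVector F R := by
  have hzero := G.inner_outLaplacianWith_eq_zero_iff.1 hg
  have hre := G.eq_sum_gammaLeft_of_rateLaplacian_eq_zero hF (f := fun x => (g x).re) <|
    funext fun y => by
      simpa [rateLaplacian_apply, transposedWeight] using congrArg Complex.re (hzero y)
  have him := G.eq_sum_gammaLeft_of_rateLaplacian_eq_zero hF (f := fun x => (g x).im) <|
    funext fun y => by
      simpa [rateLaplacian_apply, transposedWeight] using congrArg Complex.im (hzero y)
  refine funext fun x => ?_
  have hsum : (∑ R : Reach (transposeEdges F), g R.root • G.leftVector F R) x =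
      ∑ R : Reach (transposeEdges F), g R.root * (G.gammaLeft F R x : ℂ) :=
    Finset.sum_apply (M := fun _ : V => ℂ) x _ _
  rw [hsum]
  refine Complex.ext ?_ ?_
  · simpa using congrFun hre x
  · simpa using congrFun him x

theorem outLaplacianOn_mul_kernelProjection :
    G.outLaplacianOn F * G.kernelProjection F = 0 :=
  mul_biorthogonalProjection_eq_zero G.outLaplacianOn_rightVector

theorem exists_one_sub_kernelProjection_eq (hF : F ⊆ G.edges) :
    ∃ Z : G.Ell2 →L[ℂ] G.Ell2, 1 - G.kernelProjection F = G.outLaplacianOn F * Z := by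
  classical
  refine exists_one_sub_biorthogonalProjection_eq_mul (G.inner_leftVector_rightVector hF)
    fun g hg => ?_
  rw [G.eq_sum_smul_leftVector hF hg]
  exact Submodule.sum_mem _ fun R _ =>
    Submodule.smul_mem _ _ (Submodule.subset_span (Set.mem_range_self R))

theorem rieszProjection_outLaplacianOn (hF : F ⊆ G.edges) :
    rieszProjection (G.outLaplacianOn F) = G.kernelProjection F := by
  classical
  obtain ⟨Z, hZ⟩ := G.exists_one_sub_kernelProjection_eq hF
  exact rieszProjection_eq
    (isIdempotentElem_biorthogonalProjection (G.inner_leftVector_rightVector hF))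
    G.outLaplacianOn_mul_kernelProjection
    (biorthogonalProjection_mul_eq_zero (G.inner_leftVector_outLaplacianOn hF)) hZ

end KernelProjection

end WeightedDigraph

section Intertwining

variable {𝕜 E E' : Type*} [RCLike 𝕜] [NormedAddCommGroup E] [NormedAddCommGroup E']
  [NormedSpace 𝕜 E] [NormedSpace 𝕜 E'] [CompleteSpace E] [CompleteSpace E']

theorem exp_comp_eq_comp_exp {X : E →L[𝕜] E} {Y : E' →L[𝕜] E'} {U : E' →L[𝕜] E}
    (h : X.comp U = U.comp Y) : (NormedSpace.exp X).comp U = U.comp (NormedSpace.exp Y) := by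
  have hpow (n : ℕ) : (X ^ n).comp U = U.comp (Y ^ n) := by
    induction n with
    | zero => rfl
    | succ n ih =>
      rw [pow_succ X, pow_succ Y, ContinuousLinearMap.mul_def, ContinuousLinearMap.mul_def,
        ContinuousLinearMap.comp_assoc, h, ← ContinuousLinearMap.comp_assoc, ih,
        ContinuousLinearMap.comp_assoc]
  have hX := (NormedSpace.exp_series_hasSum_exp' (𝕂 := 𝕜) X).mapL
    ((ContinuousLinearMap.compL 𝕜 E' E E).flip U)
  have hY := (NormedSpace.exp_series_hasSum_exp' (𝕂 := 𝕜) Y).mapL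
    (ContinuousLinearMap.compL 𝕜 E' E' E U)
  refine hX.unique (hY.congr_fun fun n => ?_)
  simp only [ContinuousLinearMap.flip_apply, ContinuousLinearMap.compL_apply, map_smul,
    hpow]

end Intertwining

namespace WeightedDigraph

section ReducedGraph

variable {V : Type*} [Fintype V] (G : WeightedDigraph V) {F : Set (V × V)}

theorem inner_chi_rightVector [DecidableEq (Reach (transposeEdges F))] (hF : F ⊆ G.edges)
    (R S : Reach (transposeEdges F)) :
    inner ℂ (G.chi R.1) (G.rightVector F S) = if R = S then 1 else 0 := by
  rw [← G.inner_leftVector_rightVector hF, inner_eq_sum, inner_eq_sum]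
  refine Finset.sum_congr rfl fun x _ => ?_
  rw [leftVector_apply, rightVector_apply]
  by_cases h : G.gammaRight F S x = 0
  · rw [h, Complex.ofReal_zero, mul_zero, mul_zero]
  · have hx := G.isRoot_of_gammaRight_ne_zero h
    have hchi : G.chi R.1 x = G.gammaLeft F R x := by
      rw [G.gammaLeft_of_isRoot hx]
      split_ifs with hRS
      · exact (Set.indicator_of_mem (hRS ▸ hx.mem) _).trans Complex.ofReal_one.symm
      · exact (Set.indicator_of_notMem (fun hxR => hRS (hx.eq_of_mem hxR)) _).trans
          Complex.ofReal_zero.symm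
    rw [hchi]

theorem inner_leftVector_chi (R : Reach (transposeEdges F)) :
    inner ℂ (G.leftVector F R) (G.chi R.1) = ((∑ x, G.m x * G.gammaLeft F R x : ℝ) : ℂ) := by
  rw [inner_eq_sum, Complex.ofReal_sum]
  refine Finset.sum_congr rfl fun x _ => ?_
  rw [leftVector_apply, Complex.conj_ofReal, chi, Complex.ofReal_mul, mul_comm (G.m x : ℂ)]
  by_cases hx : x ∈ R.1
  · rw [Set.indicator_of_mem hx, mul_one]
  · rw [Set.indicator_of_notMem hx, G.gammaLeft_of_notMem hx, Complex.ofReal_zero, mul_zero]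

theorem reducedMass_eq_sum (hF : F ⊆ G.edges) (R : Reach (transposeEdges F)) :
    G.reducedMass F R = ∑ x, G.m x * G.gammaLeft F R x := by
  classical
  simp only [reducedMass, G.rieszProjection_outLaplacianOn hF, kernelProjection,
    biorthogonalProjection_apply, inner_sum, inner_smul_right, G.inner_chi_rightVector hF, mul_ite,
    mul_one, mul_zero, Finset.sum_ite_eq, Finset.mem_univ, if_true, inner_leftVector_chi,
    Complex.ofReal_re]

theorem reducedMass_pos (hF : F ⊆ G.edges) (R : Reach (transposeEdges F)) :
    0 < G.reducedMass F R := by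
  classical
  rw [G.reducedMass_eq_sum hF]
  refine Finset.sum_pos' (fun x _ => mul_nonneg (G.m_pos x).le (G.gammaLeft_nonneg hF R x))
    ⟨R.root, Finset.mem_univ _, ?_⟩
  rw [G.gammaLeft_of_isRoot R.isRoot_root, if_pos rfl, mul_one]
  exact G.m_pos _

variable (F) in
/-- The weight `∑ r s, γLeft_R r * a r s * γRight_S s` of the transition from `S` to `R` per unit
of reduced mass of `S`. -/
noncomputable def transferWeight (R S : Reach (transposeEdges F)) : ℝ :=
  ∑ r, ∑ s, G.gammaLeft F R r * G.a r s * G.gammaRight F S s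

theorem reducedWeight_eq_transferWeight_mul (R S : Reach (transposeEdges F)) :
    G.reducedWeight F R S = G.transferWeight F R S * G.reducedMass F S := by
  classical
  have hsum (r : V) : ∑ s with s ∈ S.1, G.gammaLeft F R r * G.a r s * G.gammaRight F S s =
      ∑ s, G.gammaLeft F R r * G.a r s * G.gammaRight F S s :=
    Finset.sum_filter_of_ne fun s _ hs =>
      (G.isRoot_of_gammaRight_ne_zero (right_ne_zero_of_mul hs)).mem
  simp only [reducedWeight, transferWeight, hsum]
  congr 1
  refine Finset.sum_filter_of_ne fun r _ hr => not_not.1 fun hn => hr ?_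
  simp only [G.gammaLeft_of_notMem hn, zero_mul, Finset.sum_const_zero]

theorem reducedWeight_nonneg (hF : F ⊆ G.edges) (R S : Reach (transposeEdges F)) :
    0 ≤ G.reducedWeight F R S := by
  rw [reducedWeight_eq_transferWeight_mul]
  refine mul_nonneg (Finset.sum_nonneg fun r _ => Finset.sum_nonneg fun s _ => ?_)
    (G.reducedMass_pos hF S).le
  exact mul_nonneg (mul_nonneg (G.gammaLeft_nonneg hF R r) (G.a_nonneg r s))
    (G.gammaRight_nonneg S s)

theorem sum_transferWeight (hF : F ⊆ G.edges) (S : Reach (transposeEdges F)) :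
    ∑ R, G.transferWeight F R S = ∑ s, ∑ r, G.a r s * G.gammaRight F S s := by
  simp only [transferWeight]
  calc ∑ R, ∑ r, ∑ s, G.gammaLeft F R r * G.a r s * G.gammaRight F S s
      = ∑ r, ∑ s, ∑ R, G.gammaLeft F R r * G.a r s * G.gammaRight F S s := by
        rw [Finset.sum_comm]
        exact Finset.sum_congr rfl fun r _ => Finset.sum_comm
    _ = ∑ r, ∑ s, G.a r s * G.gammaRight F S s := by
        simp only [← Finset.sum_mul, G.sum_gammaLeft hF, one_mul]
    _ = ∑ s, ∑ r, G.a r s * G.gammaRight F S s := Finset.sum_comm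

theorem outLaplacianOn_diff_add :
    G.outLaplacianOn (G.edges \ F) + G.outLaplacianOn F = G.outLaplacian := by
  have h := G.outLaplacianWith_add_smul (G.restrictWeight (G.edges \ F)) (G.restrictWeight F) 1
  simp only [one_smul, one_mul, restrictWeight_diff_add] at h
  exact h

theorem inner_leftVector_outLaplacian_rightVector [DecidableEq (Reach (transposeEdges F))]
    (hF : F ⊆ G.edges) (R S : Reach (transposeEdges F)) :
    inner ℂ (G.leftVector F R) (G.outLaplacian (G.rightVector F S)) =
      (((if R = S then ∑ T, G.transferWeight F T S else 0) - G.transferWeight F R S : ℝ) : ℂ) := by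
  have hdiag : ∑ s, ∑ r, G.a r s * (G.gammaLeft F R s * G.gammaRight F S s) =
      if R = S then ∑ T, G.transferWeight F T S else 0 := by
    simp only [gammaLeft_mul_gammaRight, G.sum_transferWeight hF]
    split_ifs <;> simp only [mul_zero, Finset.sum_const_zero]
  rw [outLaplacian, inner_outLaplacianWith, ← hdiag, transferWeight,
    Finset.sum_comm (f := fun r s => G.gammaLeft F R r * G.a r s * G.gammaRight F S s),
    ← Finset.sum_sub_distrib]
  simp only [← Finset.sum_sub_distrib, leftVector_apply, rightVector_apply, map_sum, map_mul,
    map_sub, Complex.conj_ofReal, Finset.sum_mul, Complex.ofReal_sum, Complex.ofReal_sub,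
    Complex.ofReal_mul]
  exact Finset.sum_congr rfl fun y _ => Finset.sum_congr rfl fun x _ => by ring

variable (hm : ∀ R, 0 < G.reducedMass F R) (ha : ∀ R S, 0 ≤ G.reducedWeight F R S)

theorem interpolateUp_apply (f : (G.reducedGraph F hm ha).Ell2) :
    G.interpolateUp F hm ha f = ∑ R, ((G.reducedMass F R : ℂ) * f R) • G.rightVector F R :=
  funext fun v => (Finset.sum_apply (M := fun _ : V => ℂ) v Finset.univ fun R =>
    ((G.reducedMass F R : ℂ) * f R) • G.rightVector F R).symm

theorem projectDown_apply (f : G.Ell2) (R : Reach (transposeEdges F)) :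
    G.projectDown F hm ha f R = inner ℂ (G.leftVector F R) f / (G.reducedMass F R : ℂ) := rfl

theorem interpolateUp_comp_projectDown :
    (G.interpolateUp F hm ha).comp (G.projectDown F hm ha) = G.kernelProjection F := by
  refine ContinuousLinearMap.ext fun f => ?_
  rw [ContinuousLinearMap.comp_apply, interpolateUp_apply, kernelProjection,
    biorthogonalProjection_apply]
  refine Finset.sum_congr rfl fun R _ => ?_
  rw [projectDown_apply, mul_div_cancel₀ _ (Complex.ofReal_ne_zero.2 (hm R).ne')]

theorem outLaplacianOn_interpolateUp (f : (G.reducedGraph F hm ha).Ell2) :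
    G.outLaplacianOn F (G.interpolateUp F hm ha f) = 0 := by
  simp only [interpolateUp_apply, map_sum, map_smul, outLaplacianOn_rightVector, smul_zero,
    Finset.sum_const_zero]

theorem outLaplacianOn_diff_interpolateUp (f : (G.reducedGraph F hm ha).Ell2) :
    G.outLaplacianOn (G.edges \ F) (G.interpolateUp F hm ha f) =
      G.outLaplacian (G.interpolateUp F hm ha f) := by
  rw [← G.outLaplacianOn_diff_add (F := F), add_apply, outLaplacianOn_interpolateUp, add_zero]

theorem projectDown_comp_outLaplacianOn_comp_interpolateUp (hF : F ⊆ G.edges) :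
    (G.projectDown F hm ha).comp ((G.outLaplacianOn (G.edges \ F)).comp (G.interpolateUp F hm ha)) =
      (G.reducedGraph F hm ha).outLaplacian := by
  classical
  refine ContinuousLinearMap.ext fun f => funext fun R => ?_
  change G.projectDown F hm ha (G.outLaplacianOn (G.edges \ F) (G.interpolateUp F hm ha f)) R =
    (1 / (G.reducedMass F R : ℂ)) * ((∑ S, (G.reducedWeight F S R : ℂ)) * f R -
      ∑ S, (G.reducedWeight F R S : ℂ) * f S)
  rw [outLaplacianOn_diff_interpolateUp, projectDown_apply, div_eq_mul_one_div, mul_comm,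
    interpolateUp_apply]
  congr 1
  simp only [map_sum, inner_sum, map_smul, inner_smul_right,
    G.inner_leftVector_outLaplacian_rightVector hF, Complex.ofReal_sub, mul_sub,
    Finset.sum_sub_distrib, apply_ite Complex.ofReal, Complex.ofReal_zero, mul_ite, mul_zero,
    Finset.sum_ite_eq, Finset.mem_univ, if_true, reducedWeight_eq_transferWeight_mul,
    Complex.ofReal_mul, Complex.ofReal_sum, ← Finset.sum_mul]
  congr 1
  · ring
  · exact Finset.sum_congr rfl fun S _ => by ring

theorem exp_mul_kernelProjection (hF : F ⊆ G.edges) (t : ℝ) :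
    NormedSpace.exp (-t • (G.kernelProjection F * G.outLaplacianOn (G.edges \ F))) *
        G.kernelProjection F =
      (G.interpolateUp F hm ha).comp
        ((NormedSpace.exp (-t • (G.reducedGraph F hm ha).outLaplacian)).comp
          (G.projectDown F hm ha)) := by
  have hintertwine : (-t • (G.kernelProjection F * G.outLaplacianOn (G.edges \ F))).comp
      (G.interpolateUp F hm ha) =
        (G.interpolateUp F hm ha).comp (-t • (G.reducedGraph F hm ha).outLaplacian) := by
    rw [← G.interpolateUp_comp_projectDown hm ha,
      ← G.projectDown_comp_outLaplacianOn_comp_interpolateUp hm ha hF,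
      ContinuousLinearMap.smul_comp, ContinuousLinearMap.comp_smul]
    rfl
  have : CompleteSpace G.Ell2 := FiniteDimensional.complete ℂ _
  have : CompleteSpace (G.reducedGraph F hm ha).Ell2 := FiniteDimensional.complete ℂ _
  have hexp := exp_comp_eq_comp_exp hintertwine
  rw [← ContinuousLinearMap.comp_assoc, ← hexp, ContinuousLinearMap.comp_assoc,
    interpolateUp_comp_projectDown]
  rfl

end ReducedGraph

end WeightedDigraph

theorem mainTheorem7 {V : Type*} [Fintype V] (G : WeightedDigraph V) (F : Set (V × V))
    (hF : F ⊆ G.edges) :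
    ∃ (hm : ∀ R, 0 < G.reducedMass F R) (ha : ∀ R S, 0 ≤ G.reducedWeight F R S),
      ∀ t : ℝ, 0 < t →
        Tendsto
          (fun β : ℝ =>
            ‖NormedSpace.exp (-(t : ℂ) • G.outLaplacianCoupled F β) -
              (G.interpolateUp F hm ha).comp
                ((NormedSpace.exp (-(t : ℂ) • (G.reducedGraph F hm ha).outLaplacian)).comp
                  (G.projectDown F hm ha))‖)
          atTop (𝓝 0) := by
  refine ⟨G.reducedMass_pos hF, G.reducedWeight_nonneg hF, fun t ht => ?_⟩
  obtain ⟨Z, hZ⟩ := G.exists_one_sub_kernelProjection_eq hF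
  have hlim := G.tendsto_exp_outLaplacianCoupled F G.outLaplacianOn_mul_kernelProjection hZ ht
  rw [G.exp_mul_kernelProjection (G.reducedMass_pos hF) (G.reducedWeight_nonneg hF) hF,
    tendsto_iff_norm_sub_tendsto_zero] at hlim
  simp only [← Complex.ofReal_neg]
  exact hlim
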